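/- Let $p$ be an odd prime number. Then there exist a finite group $G$ of order $2p^2$ and a finite Galois extension $E/\mathbb{Q}(T)$ with Galois group isomorphic to $G$ which is $\mathbb{Q}$-regular (i.e. $E\cap\overline{\mathbb{Q}}=\mathbb{Q}$) such that the following three conditions hold: (1) $G$ is isomorphic to a subgroup of $\mathrm{PGL}_2(\overline{\mathbb{F}_p})$, but $G$ is not isomorphic to any subgroup of $\mathrm{PGL}_2(\mathbb{C})$; (2) there exists $t_0\in\mathbb{Q}$ such that the specialisation $E_{t_0}$ is totally imaginary; (3) there exists $t_0\in\mathbb{Q}$ such that the specialisation $E_{t_0}/\mathbb{Q}$ is unramified at $p$. Here, for $t_0\in\mathbb{Q}$, the specialisation $E_{t_0}$ is the residue field, at a maximal ideal lying over $\langle T-t_0\rangle$, of the integral closure of $\mathbb{Q}[T]$ in $E$; it is a number field, and since $E/\mathbb{Q}(T)$ is Galois it does not depend, up to isomorphism, on the choice of the maximal ideal. -/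

import Mathlib

open scoped Polynomial RatFunc MatrixGroups NumberField

/-- A field extension `E` of `k(T)` is `k`-regular if every element of `E` that is algebraic over
`k` lies in `k`, that is, if `E ∩ k̄ = k`. -/
def IsRegularExtension (k E : Type*) [Field k] [Field E] [Algebra k E] : Prop :=
  algebraicClosure k E = ⊥

section Specialisation

variable (k E : Type*) [Field k] [Field E] [Algebra k[X] E] [Algebra k⟮X⟯ E]
  [IsScalarTower k[X] k⟮X⟯ E]

/-- There is a maximal ideal of the integral closure of `k[T]` in `E` above `⟨T - t⟩`. -/
theorem exists_isMaximal_liesOver_X_sub_C (t : k) :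
    ∃ P : Ideal (FunctionField.ringOfIntegers k E),
      P.IsMaximal ∧ P.LiesOver (Ideal.span {(Polynomial.X - Polynomial.C t : k[X])}) := by
  have h1 : (Ideal.span {(Polynomial.X - Polynomial.C t : k[X])}).IsMaximal :=
    PrincipalIdealRing.isMaximal_of_irreducible (Polynomial.irreducible_X_sub_C t)
  have h2 : FaithfulSMul k[X] (FunctionField.ringOfIntegers k E) :=
    (faithfulSMul_iff_algebraMap_injective _ _).2
      (FunctionField.ringOfIntegers.algebraMap_injective k E)
  have h3 : Algebra.IsIntegral k[X] (FunctionField.ringOfIntegers k E) :=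
    IsIntegralClosure.isIntegral_algebra k[X] E
  exact Ideal.exists_maximal_ideal_liesOver_of_isIntegral _

/-- A maximal ideal of the integral closure of `k[T]` in `E` above `⟨T - t⟩`. -/
noncomputable def specialisationIdeal (t : k) : Ideal (FunctionField.ringOfIntegers k E) :=
  (exists_isMaximal_liesOver_X_sub_C k E t).choose

instance specialisationIdeal_isMaximal (t : k) : (specialisationIdeal k E t).IsMaximal :=
  (exists_isMaximal_liesOver_X_sub_C k E t).choose_spec.1

instance specialisationIdeal_liesOver (t : k) :
    (specialisationIdeal k E t).LiesOver
      (Ideal.span {(Polynomial.X - Polynomial.C t : k[X])}) :=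
  (exists_isMaximal_liesOver_X_sub_C k E t).choose_spec.2

/-- The specialisation `E_t` of the extension `E/k(T)` at `t ∈ k`: the residue field, at a maximal
ideal above `⟨T - t⟩`, of the integral closure of `k[T]` in `E`. When `E/k(T)` is Galois, it does
not depend, up to isomorphism over `k`, on the choice of that ideal. -/
abbrev Specialisation (t : k) : Type _ :=
  (specialisationIdeal k E t).ResidueField

end Specialisation

/-- A number field `F` is unramified at `p`: all prime ideals of its ring of integers above `pℤ` are
unramified over `ℤ`. -/
def IsUnramifiedAtNat (F : Type*) [Field F] (p : ℕ) : Prop :=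
  Algebra.IsUnramifiedIn (𝓞 F) (Ideal.span {(p : ℤ)})

/-!
The group is the generalized dihedral group `G = (ℤ/p)² ⋊ {±1}` (`GenDihedral`).

*Group theory.* The affine maps `x ↦ ε x + l v`, with `l : (ℤ/p)² → F` additive and injective,
embed `G` in `PGL₂(F)` when `F` is a field of characteristic `p` with more than `p` elements. Over
`ℂ`, two commuting elements of the same odd order of `PGL₂` lift to commuting matrices, so that a
finite abelian subgroup of odd prime exponent has a common eigenvector and embeds in `ℂˣ`; it is
therefore cyclic (`isCyclic_of_injective_toPGL`), which `(ℤ/p)²` is not.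

*The extension.* Let `K = ℚ(ζ)` with `ζ` a primitive `p`-th root of unity, let `s² = T`, and for
`c = 1, 2` let `y_c = (c ζ s + (1 - s²)) / (c ζ s - (1 - s²))`. The involution `s ↦ -s` inverts
`y_c`. Write `τ_a` for the automorphism `ζ ↦ ζ ^ a` of `K`. Then `x_c = ∏ a, τ_a⁻¹(y_c) ^ a`, the
product being over `1 ≤ a < p`, satisfies `τ_b(x_c) = x_c ^ b` up to `p`-th powers. Hence
`M = K(s, x_1^(1/p), x_2^(1/p))` is Galois over `ℚ(T)`, the group of `M` over `K(T)` is `G`, and a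
suitable lift of `Gal(K/ℚ)` to `M` commutes with it. The fixed field `E` of this lift is Galois over
`ℚ(T)` with group `G` (`DihedralKummerData.exists_extension`). That the Kummer extension has full
degree `p²` follows by looking at multiplicities of places (`dvd_of_prod_quad_eq_pow`).

*Laurent expansions.* At `s = 1`, which is not a branch point, `y_c` takes the value `1`; so it has
a `p`-th root among power series in `s - 1` over `K`, and `M` embeds in the field of Laurent series
over `K`. The lift of `Gal(K/ℚ)` is its action on coefficients, and so the elements of `E` are those
of `M` whose expansions have rational coefficients (`exists_genDihedral_extension`). This shows at
once that `E` is regular over `ℚ` (`isRegularExtension_of_laurent`) and that `T = 1` splits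
completely in `E`, the specialisation at `1` being `ℚ`, which is unramified everywhere
(`isUnramifiedAtNat_specialisation`). The specialisation at `-1` contains a square root of `-1`,
since `s ∈ E`, and so it is totally imaginary (`isTotallyComplex_specialisation`).
-/


/-! ### The generalized dihedral group and `PGL₂` -/

/-- The action of `ℤˣ = {±1}` on an abelian group in which `-1` acts by inversion. -/
def signMulAut (A : Type*) [CommGroup A] : ℤˣ →* MulAut A where
  toFun ε :=
    { toFun := fun a => a ^ (ε : ℤ)
      invFun := fun a => a ^ (ε : ℤ)
      left_inv := fun a => by simp only [← zpow_mul, Int.units_coe_mul_self, zpow_one]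
      right_inv := fun a => by simp only [← zpow_mul, Int.units_coe_mul_self, zpow_one]
      map_mul' := fun a b => mul_zpow a b _ }
  map_one' := by ext a; simp
  map_mul' ε δ := by
    ext a
    change a ^ ((ε * δ : ℤˣ) : ℤ) = (a ^ (δ : ℤ)) ^ (ε : ℤ)
    rw [← zpow_mul, mul_comm, Units.val_mul]

/-- The generalized dihedral group `(ℤ/p)² ⋊ {±1}`, where `-1` acts by inversion. -/
abbrev GenDihedral (p : ℕ) : Type :=
  SemidirectProduct (Multiplicative (Fin 2 → ZMod p)) ℤˣ
    (signMulAut (Multiplicative (Fin 2 → ZMod p)))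

namespace GenDihedral

theorem natCard (p : ℕ) [NeZero p] : Nat.card (GenDihedral p) = 2 * p ^ 2 := by
  rw [SemidirectProduct.card, Nat.card_congr Multiplicative.toAdd, Nat.card_fun, Nat.card_zmod,
    Nat.card_fin, Nat.card_eq_fintype_card, Fintype.card_units_int]
  ring

theorem toAdd_mul_left {p : ℕ} (g h : GenDihedral p) :
    (g * h).left.toAdd = g.left.toAdd + ((g.right : ℤˣ) : ℤ) • h.left.toAdd := by
  rfl

section Affine

variable {p : ℕ} {k : Type*} [Field k] (l : (Fin 2 → ZMod p) →+ k)

/-- The affine transformation `x ↦ ε x + l v` as an element of `GL₂`. -/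
noncomputable def affine (g : GenDihedral p) : GL (Fin 2) k :=
  Matrix.GeneralLinearGroup.mkOfDetNeZero !![((g.right : ℤ) : k), l g.left.toAdd; 0, 1] (by
    rcases Int.units_eq_one_or g.right with h | h <;> simp [h])

theorem coe_affine (g : GenDihedral p) :
    (affine l g : Matrix (Fin 2) (Fin 2) k) =
      !![((g.right : ℤ) : k), l g.left.toAdd; 0, 1] := rfl

/-- The group `(ℤ/p)² ⋊ {±1}` acts on a field by affine transformations. -/
noncomputable def affineHom : GenDihedral p →* GL (Fin 2) k :=
  MonoidHom.mk' (affine l) (by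
    intro g h
    apply Units.ext
    rw [Units.val_mul, coe_affine, coe_affine, coe_affine, toAdd_mul_left, map_add, map_zsmul]
    ext i j
    fin_cases i <;> fin_cases j <;> simp [Matrix.mul_apply, Fin.sum_univ_two, add_comm])

theorem exists_injective_toPGL [Fact p.Prime] (hp : p ≠ 2) [CharP k p]
    (hl : Function.Injective l) :
    ∃ φ : GenDihedral p →* PGL(2, k), Function.Injective φ := by
  refine ⟨Matrix.ProjGenLinGroup.mk.comp (affineHom l), ?_⟩
  rw [injective_iff_map_eq_one]
  intro g hg
  rw [MonoidHom.comp_apply, Matrix.ProjGenLinGroup.mk_eq_one,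
    Matrix.GeneralLinearGroup.center_eq_range_scalar] at hg
  obtain ⟨u, hu⟩ := hg
  have hu' : (Matrix.scalar (Fin 2) (u : k)) = affine l g := congrArg Units.val hu
  rw [coe_affine] at hu'
  have h00 := congrFun (congrFun hu' 0) 0
  have h01 := congrFun (congrFun hu' 0) 1
  have h11 := congrFun (congrFun hu' 1) 1
  simp at h00 h01 h11
  have hl0 : g.left = 1 := by
    apply Multiplicative.toAdd.injective
    apply hl
    rw [← h01]; simp
  have hr : g.right = 1 := by
    rcases Int.units_eq_one_or g.right with h | h
    · exact h
    · exfalso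
      rw [h11, h] at h00
      have : ((2 : ℕ) : k) = 0 := by
        have h' : (1 : k) = -1 := by simpa using h00
        push_cast
        linear_combination h'
      rw [CharP.cast_eq_zero_iff k p] at this
      exact hp ((Nat.prime_dvd_prime_iff_eq Fact.out Nat.prime_two).1 this)
  exact SemidirectProduct.ext hl0 hr

end Affine

theorem exists_injective_toPGL_algebraicClosure (p : ℕ) [Fact p.Prime] (hp : p ≠ 2) :
    ∃ φ : GenDihedral p →* PGL(2, AlgebraicClosure (ZMod p)), Function.Injective φ := by
  set k := AlgebraicClosure (ZMod p)
  -- `1` and `θ` span a copy of `(ℤ/p)²` in the additive group of the field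
  obtain ⟨θ, hθ⟩ : ∃ θ : k, θ ∉ Set.range (algebraMap (ZMod p) k) := by
    by_contra! h
    have : Infinite k := IsAlgClosed.instInfinite
    exact Set.infinite_univ ((Set.finite_range (algebraMap (ZMod p) k)).subset fun x _ => h x)
  have : CharP k p := charP_of_injective_algebraMap (algebraMap (ZMod p) k).injective p
  let l : (Fin 2 → ZMod p) →+ k :=
    ((algebraMap (ZMod p) k : ZMod p →+ k).comp (Pi.evalAddMonoidHom _ 0)) +
      (AddMonoidHom.mulRight θ).comp
        ((algebraMap (ZMod p) k : ZMod p →+ k).comp (Pi.evalAddMonoidHom _ 1))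
  have hl : ∀ a, l a = algebraMap (ZMod p) k (a 0) + algebraMap (ZMod p) k (a 1) * θ := fun a => rfl
  refine exists_injective_toPGL l hp ((injective_iff_map_eq_zero l).2 ?_)
  intro a h
  rw [hl] at h
  by_cases hb : a 1 = 0
  · ext i
    fin_cases i
    · simpa [hb] using h
    · exact hb
  · refine absurd ⟨-a 0 / a 1, ?_⟩ hθ
    have hb' : algebraMap (ZMod p) k (a 1) ≠ 0 := by simpa using hb
    rw [map_div₀, map_neg, div_eq_iff hb']
    linear_combination -h

end GenDihedral

section PGL2

open Matrix

variable {k : Type*} [Field k]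

/-- Lifts to `GL₂` of commuting elements of `PGL₂` of odd order `p` commute: their commutator is a
scalar `c`, with `c² = 1` by determinants and `c ^ p = 1`. -/
theorem commute_of_mk_commute {p : ℕ} (hp : Odd p) {A B : GL (Fin 2) k}
    (h : ProjGenLinGroup.mk (A * B) = ProjGenLinGroup.mk (B * A))
    (hA : ProjGenLinGroup.mk (A ^ p) = 1) : A * B = B * A := by
  rw [ProjGenLinGroup.mk_eq_mk_iff] at h
  obtain ⟨u, hu⟩ := h
  rw [ProjGenLinGroup.mk_eq_one] at hA
  have hsc : ∀ g : GL (Fin 2) k, Commute (GeneralLinearGroup.scalar (Fin 2) u) g := fun g => by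
    have : GeneralLinearGroup.scalar (Fin 2) u ∈ Subgroup.center (GL (Fin 2) k) := by
      rw [GeneralLinearGroup.center_eq_range_scalar]; exact ⟨u, rfl⟩
    exact (Subgroup.mem_center_iff.1 this g).symm
  have hdet : u ^ 2 = 1 := by
    have := congrArg GeneralLinearGroup.det hu
    simp only [map_mul] at this
    rw [mul_comm (GeneralLinearGroup.det B), mul_eq_left] at this
    rw [← this]
    apply Units.ext
    simp [sq]
  have hconj : B * A * B⁻¹ = A * GeneralLinearGroup.scalar (Fin 2) u := by
    rw [← hu, mul_assoc, (hsc _).eq, ← mul_assoc, mul_inv_cancel_right]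
  have hpow : u ^ p = 1 := by
    have h1 : (B * A * B⁻¹) ^ p = A ^ p := by
      rw [conj_pow, Subgroup.mem_center_iff.1 hA B, mul_inv_cancel_right]
    have h3 : (A * GeneralLinearGroup.scalar (Fin 2) u) ^ p =
        A ^ p * GeneralLinearGroup.scalar (Fin 2) u ^ p := (hsc A).symm.mul_pow p
    rw [hconj, h3, mul_eq_left] at h1
    have h2 : scalar (Fin 2) (u : k) ^ p = scalar (Fin 2) 1 := by
      rw [map_one]
      exact congrArg Units.val h1
    rw [← map_pow, scalar_inj] at h2
    exact Units.ext (by rw [Units.val_pow_eq_pow_val, h2, Units.val_one])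
  have hu1 : u = 1 := by
    have h2 : Nat.Coprime 2 p := (Nat.coprime_two_left).2 hp
    have := orderOf_dvd_of_pow_eq_one hdet
    have h3 := orderOf_dvd_of_pow_eq_one hpow
    exact orderOf_eq_one_iff.1 (Nat.eq_one_of_dvd_coprimes h2 this h3)
  rw [← hu, hu1, map_one, mul_one]

/-- If a nonzero `2 × 2` matrix kills two vectors, these are proportional. -/
theorem exists_smul_of_mulVec_eq_zero {M : Matrix (Fin 2) (Fin 2) k} (hM : M ≠ 0)
    {v w : Fin 2 → k} (hv : v ≠ 0) (hMv : M *ᵥ v = 0) (hMw : M *ᵥ w = 0) :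
    ∃ c : k, w = c • v := by
  have hd : v 0 * w 1 = v 1 * w 0 := by
    by_contra hne
    apply hM
    have hne' : v 0 * w 1 - v 1 * w 0 ≠ 0 := sub_ne_zero.2 hne
    ext i j
    have h1 := congrFun hMv i
    have h2 := congrFun hMw i
    simp only [mulVec, dotProduct, Fin.sum_univ_two, Pi.zero_apply] at h1 h2
    fin_cases j
    · refine (mul_eq_zero.1 (?_ : M i 0 * (v 0 * w 1 - v 1 * w 0) = 0)).resolve_right hne'
      linear_combination w 1 * h1 - v 1 * h2
    · refine (mul_eq_zero.1 (?_ : M i 1 * (v 0 * w 1 - v 1 * w 0) = 0)).resolve_right hne'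
      linear_combination v 0 * h2 - w 0 * h1
  by_cases h0 : v 0 = 0
  · have h1 : v 1 ≠ 0 := by
      intro h1; apply hv; ext i; fin_cases i <;> simp [h0, h1]
    refine ⟨w 1 / v 1, ?_⟩
    have hw : w 0 = 0 := by
      rw [h0, zero_mul] at hd
      exact (mul_eq_zero.1 hd.symm).resolve_left h1
    ext i; fin_cases i
    · simp [h0, hw]
    · simp [h1]
  · refine ⟨w 0 / v 0, ?_⟩
    ext i; fin_cases i
    · simp [h0]
    · simp only [Fin.mk_one, Fin.isValue, Pi.smul_apply, smul_eq_mul]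
      field_simp
      linear_combination hd

/-- A `2 × 2` matrix with a double eigenvalue some power of which is scalar is itself scalar, in
characteristic zero: it is `c + N` with `N² = 0`, and `(c + N) ^ n = c ^ n + n c ^ (n - 1) N`. -/
theorem eq_scalar_of_pow_eq_scalar [CharZero k] {B : Matrix (Fin 2) (Fin 2) k} {c d : k}
    (hc : c ≠ 0) (hdet : B.det = c ^ 2) {v : Fin 2 → k} (hv : v ≠ 0) (hBv : B *ᵥ v = c • v)
    {n : ℕ} (hn : n ≠ 0) (hpow : B ^ n = scalar (Fin 2) d) : B = scalar (Fin 2) c := by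
  set N : Matrix (Fin 2) (Fin 2) k := B - scalar (Fin 2) c with hN
  have hNv : N *ᵥ v = 0 := by
    rw [hN, sub_mulVec, hBv]
    simp [← smul_one_eq_diagonal, smul_mulVec]
  have hNdet : N.det = 0 := exists_mulVec_eq_zero_iff.1 ⟨v, hv, hNv⟩
  have htr : B 0 0 + B 1 1 = 2 * c := by
    rw [det_fin_two] at hNdet hdet
    simp [hN] at hNdet
    have : c * (B 0 0 + B 1 1 - 2 * c) = 0 := by linear_combination hdet - hNdet
    exact sub_eq_zero.1 ((mul_eq_zero.1 this).resolve_left hc)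
  have hNN : N * N = 0 := by
    rw [det_fin_two] at hNdet
    have h1 : N 0 0 + N 1 1 = 0 := by simp [hN]; linear_combination htr
    ext i j
    fin_cases i <;> fin_cases j <;> simp [mul_apply, Fin.sum_univ_two]
    · linear_combination N 0 0 * h1 - hNdet
    · linear_combination N 0 1 * h1
    · linear_combination N 1 0 * h1
    · linear_combination N 1 1 * h1 - hNdet
  have hB : B = c • 1 + N := by rw [hN, smul_one_eq_diagonal]; simp
  have key : ∀ m : ℕ, B ^ (m + 1) = c ^ (m + 1) • 1 + ((m + 1 : ℕ) * c ^ m) • N := by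
    intro m
    induction m with
    | zero => simp [hB]
    | succ m ih =>
      rw [pow_succ, ih, hB]
      simp only [add_mul, mul_add, smul_mul_assoc, mul_smul_comm, one_mul, mul_one, hNN, smul_zero,
        add_zero]
      module
  obtain ⟨m, rfl⟩ := Nat.exists_eq_succ_of_ne_zero hn
  rw [Nat.succ_eq_add_one, key] at hpow
  have hne : ((m + 1 : ℕ) : k) * c ^ m ≠ 0 :=
    mul_ne_zero (Nat.cast_ne_zero.2 hn) (pow_ne_zero _ hc)
  have hNs : ∃ e : k, N = scalar (Fin 2) e := by
    refine ⟨(((m + 1 : ℕ) : k) * c ^ m)⁻¹ * (d - c ^ (m + 1)), ?_⟩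
    have : (((m + 1 : ℕ) : k) * c ^ m) • N = (d - c ^ (m + 1)) • 1 := by
      rw [sub_smul, eq_sub_iff_add_eq, add_comm, hpow, smul_one_eq_diagonal]; rfl
    rw [scalar_apply, ← smul_one_eq_diagonal, mul_smul, ← this, smul_smul, inv_mul_cancel₀ hne,
      one_smul]
  obtain ⟨e, he⟩ := hNs
  have he0 : e = 0 := by
    rw [he] at hNN
    have := congrFun (congrFun hNN 0) 0
    simpa using this
  have : N = 0 := by rw [he, he0, map_zero]
  exact sub_eq_zero.1 this

/-- A finite abelian group of odd prime exponent `p` inside `PGL₂(k)`, where `k` is algebraically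
closed of characteristic zero, is cyclic. Its elements lift to commuting matrices, which share an
eigenvector `v`; sending a lift `B` with `B v = χ v` to `χ² / det B` embeds the group into `kˣ`. -/
theorem isCyclic_of_injective_toPGL [IsAlgClosed k] [CharZero k] {N : Type*} [CommGroup N]
    [Finite N] {p : ℕ} (hp : Odd p) (hN : ∀ n : N, n ^ p = 1) (f : N →* PGL(2, k))
    (hf : Function.Injective f) : IsCyclic N := by
  classical
  rcases subsingleton_or_nontrivial N with hsub | hnt
  · infer_instance
  choose A hA using fun n : N => ProjGenLinGroup.mk_surjective (f n)
  have hpow : ∀ n, ProjGenLinGroup.mk (A n ^ p) = 1 := fun n => by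
    rw [map_pow, hA, ← map_pow, hN, map_one]
  have hcomm : ∀ n m, A n * A m = A m * A n := fun n m =>
    commute_of_mk_commute hp (by rw [map_mul, map_mul, hA, hA, ← map_mul, ← map_mul, mul_comm])
      (hpow n)
  have hscal : ∀ n c, (A n : Matrix (Fin 2) (Fin 2) k) = scalar (Fin 2) c → n = 1 := by
    intro n c h
    apply hf
    rw [map_one, ← hA, ProjGenLinGroup.mk_eq_one, GeneralLinearGroup.center_eq_range_scalar]
    have hc : c ≠ 0 := by
      rintro rfl
      have := (A n).isUnit
      rw [h, map_zero] at this
      exact not_isUnit_zero this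
    exact ⟨Units.mk0 c hc, Units.ext (by rw [h]; rfl)⟩
  obtain ⟨n₀, hn₀⟩ := exists_ne (1 : N)
  obtain ⟨α, hα⟩ := Module.End.exists_eigenvalue (toLin' (A n₀ : Matrix (Fin 2) (Fin 2) k))
  obtain ⟨v, hv⟩ := hα.exists_hasEigenvector
  have hv0 : v ≠ 0 := hv.2
  have hαv : (A n₀ : Matrix (Fin 2) (Fin 2) k) *ᵥ v = α • v := by
    simpa using hv.apply_eq_smul
  have hker : ∀ w : Fin 2 → k, (A n₀ : Matrix (Fin 2) (Fin 2) k) *ᵥ w = α • w →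
      ((A n₀ : Matrix (Fin 2) (Fin 2) k) - scalar (Fin 2) α) *ᵥ w = 0 := fun w h => by
    rw [sub_mulVec, h]
    simp [← smul_one_eq_diagonal, smul_mulVec]
  have hne : (A n₀ : Matrix (Fin 2) (Fin 2) k) - scalar (Fin 2) α ≠ 0 := fun h =>
    hn₀ (hscal n₀ α (sub_eq_zero.1 h))
  have hχ : ∀ n, ∃ c : k, (A n : Matrix (Fin 2) (Fin 2) k) *ᵥ v = c • v := fun n => by
    refine exists_smul_of_mulVec_eq_zero hne hv0 (hker v hαv) (hker _ ?_)
    have := congrArg Units.val (hcomm n₀ n)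
    rw [Units.val_mul, Units.val_mul] at this
    rw [mulVec_mulVec, this, ← mulVec_mulVec, hαv, mulVec_smul]
  choose χ hχ using hχ
  have hχ0 : ∀ n, χ n ≠ 0 := fun n h => by
    apply hv0
    have h1 := hχ n
    rw [h, zero_smul] at h1
    have h2 := congrArg (fun w => ((A n)⁻¹ : GL (Fin 2) k).1 *ᵥ w) h1
    simp only [mulVec_mulVec, mulVec_zero] at h2
    rwa [← Units.val_mul, inv_mul_cancel, Units.val_one, one_mulVec] at h2
  have hdet : ∀ n, (A n : Matrix (Fin 2) (Fin 2) k).det ≠ 0 := fun n =>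
    (GeneralLinearGroup.det (A n)).ne_zero
  -- `χ² / det` does not depend on the choice of the lifts
  let ρ : N → k := fun n => χ n ^ 2 / (A n : Matrix (Fin 2) (Fin 2) k).det
  have hsmul : ∀ a b : k, a • v = b • v → a = b := fun a b h => smul_left_injective k hv0 h
  have hρ : ∀ n m, ρ (n * m) = ρ n * ρ m := fun n m => by
    have : ProjGenLinGroup.mk (A (n * m)) = ProjGenLinGroup.mk (A n * A m) := by
      rw [map_mul, hA, hA, hA, map_mul]
    obtain ⟨u, hu⟩ := ProjGenLinGroup.mk_eq_mk_iff.1 this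
    have hu' : (A (n * m) : Matrix (Fin 2) (Fin 2) k) * scalar (Fin 2) (u : k) = A n * A m :=
      congrArg Units.val hu
    have h1 : χ (n * m) * u = χ n * χ m := by
      apply hsmul
      have h2 := congrArg (fun M => M *ᵥ v) hu'
      simp only [← mulVec_mulVec] at h2
      rw [hχ m, mulVec_smul, hχ n, scalar_apply, ← smul_one_eq_diagonal, smul_mulVec, one_mulVec,
        mulVec_smul, hχ] at h2
      rw [mul_comm, mul_smul, h2, smul_smul, mul_comm]
    have h3 := congrArg det hu'
    simp [det_mul] at h3
    simp only [ρ]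
    have hu0 := u.ne_zero
    have h4 := hdet (n * m)
    have h5 := hdet n
    have h6 := hdet m
    rw [div_mul_div_comm, ← h3, div_eq_div_iff h4 (by rw [h3]; exact mul_ne_zero h5 h6), ← mul_pow,
      ← h1]
    ring
  have hρ1 : ρ 1 = 1 := by
    have h1 := hρ 1 1
    rw [mul_one] at h1
    have h0 : ρ 1 ≠ 0 := div_ne_zero (pow_ne_zero _ (hχ0 1)) (hdet 1)
    exact (mul_eq_left₀ h0).1 h1.symm
  let ρ' : N →* k := { toFun := ρ, map_one' := hρ1, map_mul' := hρ }
  refine isCyclic_of_injective_ringHom ρ' ((injective_iff_map_eq_one ρ').2 fun n hn => ?_)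
  have hd : (A n : Matrix (Fin 2) (Fin 2) k).det = χ n ^ 2 :=
    ((div_eq_one_iff_eq (hdet n)).1 hn).symm
  obtain ⟨u, hu⟩ : A n ^ p ∈ (GeneralLinearGroup.scalar (Fin 2) : kˣ →* _).range := by
    rw [← GeneralLinearGroup.center_eq_range_scalar, ← ProjGenLinGroup.mk_eq_one]
    exact hpow n
  refine hscal n (χ n) (eq_scalar_of_pow_eq_scalar (d := u) (hχ0 n) hd hv0 (hχ n)
    hp.pos.ne' ?_)
  rw [← Units.val_pow_eq_pow_val, ← hu]
  rfl

end PGL2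

theorem GenDihedral.not_exists_injective_toPGL_complex (p : ℕ) [Fact p.Prime] (hp : p ≠ 2) :
    ¬ ∃ ψ : GenDihedral p →* PGL(2, ℂ), Function.Injective ψ := by
  rintro ⟨ψ, hψ⟩
  have hpp : p.Prime := Fact.out
  have hexp : ∀ n : Multiplicative (Fin 2 → ZMod p), n ^ p = 1 := fun n => by
    apply Multiplicative.toAdd.injective
    rw [toAdd_pow]
    ext
    simp
  have hcyc := isCyclic_of_injective_toPGL (hpp.odd_of_ne_two hp) hexp
    (ψ.comp SemidirectProduct.inl) (hψ.comp SemidirectProduct.inl_injective)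
  have h1 := hcyc.exponent_eq_card
  have h2 := Monoid.exponent_dvd_of_forall_pow_eq_one hexp
  rw [h1, Nat.card_congr Multiplicative.toAdd, Nat.card_fun, Nat.card_zmod,
    Nat.card_fin] at h2
  have := Nat.le_of_dvd hpp.pos h2
  nlinarith [hpp.two_le]

/-! ### Descent of Kummer extensions with generalized dihedral group -/

section KummerDescent

open IntermediateField

section Generalities

variable {F M Ω : Type*} [Field F] [Field M] [Algebra F M] [Field Ω] [Algebra F Ω]

theorem AlgHom.eqOn_adjoin_of_eqOn {f g : M →ₐ[F] Ω} {S : Set M} (h : Set.EqOn f g S) :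
    Set.EqOn f g (adjoin F S) := by
  intro x hx
  have := algHom_ext_of_eq_adjoin F (S := adjoin F S) rfl (φ₁ := f.comp (adjoin F S).val)
    (φ₂ := g.comp (adjoin F S).val) (fun x hx => h hx)
  exact DFunLike.congr_fun this ⟨x, hx⟩

theorem AlgHom.map_mem_fieldRange_of_adjoin_eq_top {f g : M →ₐ[F] Ω} {S : Set M}
    (hS : adjoin F S = ⊤) (h : ∀ x ∈ S, f x ∈ g.fieldRange) : f.fieldRange ≤ g.fieldRange := by
  rw [AlgHom.fieldRange_eq_map f, ← hS, adjoin_map, adjoin_le_iff]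
  rintro _ ⟨x, hx, rfl⟩
  exact h x hx

/-- An algebraic extension is normal if all its embeddings in an algebraic closure have the same
image as the inclusion. -/
theorem Normal.of_forall_fieldRange_le [Algebra.IsAlgebraic F M]
    (h : ∀ φ : M →ₐ[F] AlgebraicClosure M,
      φ.fieldRange ≤ (IsScalarTower.toAlgHom F M (AlgebraicClosure M)).fieldRange) :
    Normal F M := by
  let ι := IsScalarTower.toAlgHom F M (AlgebraicClosure M)
  have : Algebra.IsAlgebraic F (AlgebraicClosure M) := Algebra.IsAlgebraic.trans F M _
  have : Normal F (AlgebraicClosure M) := normal_iff.2 fun x =>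
    ⟨(Algebra.IsAlgebraic.isAlgebraic x).isIntegral, IsAlgClosed.splits _⟩
  have hn : Normal F ι.fieldRange := normal_iff_forall_map_le.2 fun σ => by
    rw [AlgHom.map_fieldRange]
    exact h _
  let e : ι.fieldRange ≃ₐ[F] M := (AlgEquiv.ofInjectiveField ι).symm
  exact Normal.of_algEquiv (h := hn) e

theorem zpow_pow_comm {G : Type*} [DivisionMonoid G] (x : G) (m : ℤ) (n : ℕ) :
    (x ^ m) ^ n = (x ^ n) ^ m := by
  rw [← zpow_natCast, ← zpow_natCast, ← zpow_mul, ← zpow_mul, mul_comm]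

end Generalities

/-- Data describing a Kummer extension of the quadratic extension `F(ζ, s)` of `F(ζ)`, with
`s ^ 2 ∈ F` and `ζ` a primitive `p`-th root of unity, that descends to a generalized dihedral
extension of `F`.

For `c = 1, 2` and `a ∈ (ℤ/p)ˣ`, put `y c a = (t c ζ ^ a s + 1) / (t c ζ ^ a s - 1)` with `t c ∈ F`.
The automorphism `s ↦ -s` inverts `y c a`. The element `z c` is a `p`-th root of
`∏ a, y c a⁻¹ ^ a`, an element which, up to `p`-th powers, is raised to the power `b` by the
automorphism `ζ ↦ ζ ^ b`. The `p`-th powers are explicit in `D_z`, where the exponents `a b / p` are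
the carries in `a b = (a b mod p) + p (a b / p)`. -/
structure DihedralKummerData (p : ℕ) [NeZero p] (F M : Type*) [Field F] [Field M]
    [Algebra F M] where
  /-- The lift to `M` of the Galois group of `F(ζ)` over `F`. -/
  D : (ZMod p)ˣ →* Gal(M/F)
  /-- A primitive `p`-th root of unity. -/
  ζ : M
  /-- A square root of an element of `F`. -/
  s : M
  /-- The coefficients in `F` of the two radicands. -/
  t : Fin 2 → F
  /-- The two Kummer generators. -/
  z : Fin 2 → M
  isPrimitiveRoot : IsPrimitiveRoot ζ p
  s_sq : ∃ T : F, s ^ 2 = algebraMap F M T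
  z_pow : ∀ c, z c ^ p = ∏ a : (ZMod p)ˣ,
    ((algebraMap F M (t c) * ζ ^ (a⁻¹ : (ZMod p)ˣ).val.val * s + 1) /
      (algebraMap F M (t c) * ζ ^ (a⁻¹ : (ZMod p)ˣ).val.val * s - 1)) ^ a.val.val
  D_ζ : ∀ b, D b ζ = ζ ^ b.val.val
  D_s : ∀ b, D b s = s
  D_z : ∀ b c, D b (z c) * ∏ a : (ZMod p)ˣ,
    ((algebraMap F M (t c) * ζ ^ (a⁻¹ : (ZMod p)ˣ).val.val * s + 1) /
      (algebraMap F M (t c) * ζ ^ (a⁻¹ : (ZMod p)ˣ).val.val * s - 1)) ^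
        (a.val.val * b.val.val / p) = z c ^ b.val.val
  s_notMem : s ∉ F⟮ζ⟯
  independent : ∀ m : Fin 2 → ℕ, ∀ u ∈ adjoin F {ζ, s},
    ∏ c, (z c ^ p) ^ m c = u ^ p → ∀ c, p ∣ m c

namespace DihedralKummerData

variable {p : ℕ} [Fact p.Prime] {F M : Type*} [Field F] [Field M] [Algebra F M]
  (d : DihedralKummerData p F M)

/-- The functions `(t c ζ ^ a s + 1) / (t c ζ ^ a s - 1)`. -/
def y (c : Fin 2) (a : (ZMod p)ˣ) : M :=
  (algebraMap F M (d.t c) * d.ζ ^ a.val.val * d.s + 1) /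
    (algebraMap F M (d.t c) * d.ζ ^ a.val.val * d.s - 1)

/-- The additive character `j ↦ ζ ^ j` of `ℤ/p`. -/
noncomputable def χ : AddChar (ZMod p) M := AddChar.zmodChar p d.isPrimitiveRoot.pow_eq_one

theorem χ_apply (j : ZMod p) : d.χ j = d.ζ ^ j.val := AddChar.zmodChar_apply _ _

theorem χ_injective : Function.Injective d.χ := by
  intro i j h
  rw [χ_apply, χ_apply] at h
  exact ZMod.val_injective p
    (d.isPrimitiveRoot.pow_inj (ZMod.val_lt i) (ZMod.val_lt j) h)

theorem ζ_mem : d.ζ ∈ F⟮d.ζ⟯ := mem_adjoin_simple_self F _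

theorem coeff_mem (c : Fin 2) (a : ℕ) : algebraMap F M (d.t c) * d.ζ ^ a ∈ F⟮d.ζ⟯ :=
  mul_mem (IntermediateField.algebraMap_mem _ _) (pow_mem d.ζ_mem _)

theorem coeff_mul_s_ne (c : Fin 2) (a : ℕ) {e : M} (he : e ∈ F⟮d.ζ⟯) (he0 : e ≠ 0) :
    algebraMap F M (d.t c) * d.ζ ^ a * d.s ≠ e := by
  intro h
  apply d.s_notMem
  have h0 : algebraMap F M (d.t c) * d.ζ ^ a ≠ 0 := by
    intro h'
    rw [h', zero_mul] at h
    exact he0 h.symm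
  rw [(eq_div_iff h0).2 ((mul_comm _ _).trans h)]
  exact div_mem he (d.coeff_mem c a)

theorem num_ne_zero (c : Fin 2) (a : ℕ) :
    algebraMap F M (d.t c) * d.ζ ^ a * d.s + 1 ≠ 0 := fun h =>
  d.coeff_mul_s_ne c a (neg_mem (one_mem _)) (neg_ne_zero.2 one_ne_zero)
    (eq_neg_of_add_eq_zero_left h)

theorem den_ne_zero (c : Fin 2) (a : ℕ) :
    algebraMap F M (d.t c) * d.ζ ^ a * d.s - 1 ≠ 0 := fun h =>
  d.coeff_mul_s_ne c a (one_mem _) one_ne_zero (sub_eq_zero.1 h)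

theorem y_ne_zero (c : Fin 2) (a : (ZMod p)ˣ) : d.y c a ≠ 0 :=
  div_ne_zero (d.num_ne_zero c _) (d.den_ne_zero c _)

theorem z_ne_zero (c : Fin 2) : d.z c ≠ 0 := by
  intro h
  have h1 := d.z_pow c
  rw [h, zero_pow (NeZero.ne p)] at h1
  exact Finset.prod_ne_zero_iff.2 (fun a _ => pow_ne_zero _ (d.y_ne_zero c a⁻¹)) h1.symm

theorem s_ne_zero : d.s ≠ 0 := fun h => d.s_notMem (h ▸ zero_mem _)

section Embedding

variable {Ω : Type*} [Field Ω] [Algebra F Ω] {ψ ι : M →ₐ[F] Ω}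

theorem exists_sign (ψ ι : M →ₐ[F] Ω) : ∃ ε : ℤˣ, ψ d.s = ((ε : ℤ) : Ω) * ι d.s := by
  obtain ⟨T, hT⟩ := d.s_sq
  have : ψ d.s ^ 2 = ι d.s ^ 2 := by
    rw [← map_pow, ← map_pow, hT, AlgHom.commutes, AlgHom.commutes]
  rcases sq_eq_sq_iff_eq_or_eq_neg.1 this with h | h
  · exact ⟨1, by simpa using h⟩
  · exact ⟨-1, by simpa using h⟩

theorem map_y (hζ : ψ d.ζ = ι d.ζ) {ε : ℤˣ} (hs : ψ d.s = ((ε : ℤ) : Ω) * ι d.s) (c : Fin 2)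
    (a : (ZMod p)ˣ) : ψ (d.y c a) = ι (d.y c a) ^ (ε : ℤ) := by
  rcases Int.units_eq_one_or ε with rfl | rfl
  · simp only [Units.val_one, Int.cast_one, one_mul, zpow_one] at hs ⊢
    simp only [y, map_div₀, map_add, map_sub, map_mul, map_pow, map_one, hs, hζ, AlgHom.commutes]
  · simp only [Units.val_neg, Units.val_one, Int.cast_neg, Int.cast_one, neg_mul, one_mul,
      zpow_neg, zpow_one] at hs ⊢
    simp only [y, map_div₀, map_add, map_sub, map_mul, map_pow, map_one, hs, hζ,
      AlgHom.commutes, inv_div]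
    rw [← neg_div_neg_eq]
    congr 1 <;> ring

/-- An embedding fixing `ζ` maps `s` to `± s` and, with the same sign, each `z c` to
`(ζ ^ j * z c) ^ (± 1)` for some `j`. -/
theorem exists_map_eq (hζ : ψ d.ζ = ι d.ζ) : ∃ g : GenDihedral p,
    ψ d.s = ((g.right : ℤ) : Ω) * ι d.s ∧
      ∀ c, ψ (d.z c) = (ι (d.χ (g.left.toAdd c)) * ι (d.z c)) ^ (g.right : ℤ) := by
  obtain ⟨ε, hs⟩ := d.exists_sign ψ ι
  have key : ∀ c, ∃ j : ZMod p, ψ (d.z c) ^ (ε : ℤ) = ι (d.χ j) * ι (d.z c) := by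
    intro c
    have hpow : (ψ (d.z c) ^ (ε : ℤ)) ^ p = ι (d.z c) ^ p := by
      have h1 : ψ (d.z c ^ p) = ι (d.z c ^ p) ^ (ε : ℤ) := by
        rw [d.z_pow, map_prod, map_prod, ← Finset.prod_zpow]
        refine Finset.prod_congr rfl fun a _ => ?_
        have := d.map_y hζ hs c a⁻¹
        rw [y] at this
        rw [map_pow, this, map_pow, zpow_pow_comm]
      rw [map_pow] at h1
      rw [← zpow_natCast, ← zpow_mul, mul_comm, zpow_mul, zpow_natCast, h1, ← zpow_mul,
        Int.units_coe_mul_self, zpow_one, map_pow]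
    have hz : ι (d.z c) ≠ 0 := (map_ne_zero ι).2 (d.z_ne_zero c)
    have h1 : (ψ (d.z c) ^ (ε : ℤ) / ι (d.z c)) ^ p = 1 := by
      rw [div_pow, hpow, div_self (pow_ne_zero _ hz)]
    obtain ⟨i, hi, h2⟩ :=
      (d.isPrimitiveRoot.map_of_injective (f := ι) ι.injective).eq_pow_of_pow_eq_one h1
    refine ⟨i, ?_⟩
    rw [χ_apply, ZMod.val_cast_of_lt hi, map_pow, h2, div_mul_cancel₀ _ hz]
  choose j hj using key
  refine ⟨⟨Multiplicative.ofAdd j, ε⟩, hs, fun c => ?_⟩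
  rw [toAdd_ofAdd, ← hj, ← zpow_mul, Int.units_coe_mul_self, zpow_one]

end Embedding

/-- The generators of the Kummer extension. -/
def gens : Set M := {d.ζ, d.s} ∪ Set.range d.z

theorem ζ_mem_gens : d.ζ ∈ d.gens := Or.inl (Or.inl rfl)

theorem s_mem_gens : d.s ∈ d.gens := Or.inl (Or.inr rfl)

theorem z_mem_gens (c : Fin 2) : d.z c ∈ d.gens := Or.inr ⟨c, rfl⟩

theorem isIntegral_of_mem_gens {x : M} (hx : x ∈ d.gens) : IsIntegral F x := by
  have hζ : IsIntegral F d.ζ := d.isPrimitiveRoot.isIntegral (NeZero.pos p) |>.tower_top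
  have hs : IsIntegral F d.s := by
    obtain ⟨T, hT⟩ := d.s_sq
    exact IsIntegral.of_pow two_pos (hT ▸ isIntegral_algebraMap)
  rcases hx with (rfl | rfl) | ⟨c, rfl⟩
  · exact hζ
  · exact hs
  · refine IsIntegral.of_pow (NeZero.pos p) ?_
    rw [d.z_pow]
    refine IsIntegral.prod _ fun a _ => IsIntegral.pow ?_ _
    have h : IsIntegral F (algebraMap F M (d.t c) * d.ζ ^ (a⁻¹ : (ZMod p)ˣ).val.val * d.s) :=
      (isIntegral_algebraMap.mul (hζ.pow _)).mul hs
    rw [div_eq_mul_inv]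
    exact (h.add isIntegral_one).mul (h.sub isIntegral_one).inv

theorem finiteDimensional (hd : adjoin F d.gens = ⊤) : FiniteDimensional F M := by
  have : Finite d.gens := by
    unfold gens
    exact Set.Finite.to_subtype ((Set.toFinite _).union (Set.finite_range _))
  have := finiteDimensional_adjoin (K := F) (S := d.gens) fun x hx => d.isIntegral_of_mem_gens hx
  rw [hd] at this
  exact Module.Finite.equiv (topEquiv (F := F) (E := M)).toLinearEquiv

theorem algEquiv_ext (hd : adjoin F d.gens = ⊤) {f g : Gal(M/F)} (hζ : f d.ζ = g d.ζ) (hs : f d.s = g d.s)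
    (hz : ∀ c, f (d.z c) = g (d.z c)) : f = g := by
  ext x
  refine AlgHom.eqOn_adjoin_of_eqOn (F := F) (f := (f : M →ₐ[F] M)) (g := (g : M →ₐ[F] M))
    (S := d.gens) ?_ (hd ▸ mem_top : x ∈ adjoin F d.gens)
  rintro _ ((rfl | rfl) | ⟨c, rfl⟩)
  · exact hζ
  · exact hs
  · exact hz c

theorem exists_map_ζ_eq {Ω : Type*} [Field Ω] [Algebra F Ω] (φ ι : M →ₐ[F] Ω) :
    ∃ b : (ZMod p)ˣ, φ d.ζ = ι (d.D b d.ζ) := by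
  have hφ := d.isPrimitiveRoot.map_of_injective (f := φ) φ.injective
  have hι := d.isPrimitiveRoot.map_of_injective (f := ι) ι.injective
  obtain ⟨i, hi, hcop, h⟩ := (hι.isPrimitiveRoot_iff).1 hφ
  refine ⟨ZMod.unitOfCoprime i hcop, ?_⟩
  rw [d.D_ζ, map_pow, ZMod.coe_unitOfCoprime, ZMod.val_cast_of_lt hi, h]

theorem normal (hd : adjoin F d.gens = ⊤) : Normal F M := by
  have := d.finiteDimensional hd
  refine Normal.of_forall_fieldRange_le fun φ => ?_
  set ι := IsScalarTower.toAlgHom F M (AlgebraicClosure M)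
  obtain ⟨b, hb⟩ := d.exists_map_ζ_eq φ ι
  -- after composition with a lift `D b`, the embedding fixes `ζ`
  let ψ : M →ₐ[F] AlgebraicClosure M := φ.comp ((d.D b)⁻¹ : Gal(M/F))
  have hφ : φ = ψ.comp (d.D b : M →ₐ[F] M) := by
    ext x
    change φ x = φ ((d.D b)⁻¹ (d.D b x))
    rw [← AlgEquiv.mul_apply, inv_mul_cancel, AlgEquiv.one_apply]
  have hψ : ψ d.ζ = ι d.ζ := by
    change φ ((d.D b)⁻¹ d.ζ) = ι d.ζ
    rw [← map_inv, d.D_ζ, map_pow, hb, ← map_pow, ← map_pow, ← d.D_ζ, ← AlgEquiv.mul_apply,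
      ← map_mul, mul_inv_cancel, map_one, AlgEquiv.one_apply]
  have h1 : φ.fieldRange ≤ ψ.fieldRange := by
    rintro _ ⟨x, rfl⟩
    rw [hφ]
    exact ⟨d.D b x, rfl⟩
  refine h1.trans (AlgHom.map_mem_fieldRange_of_adjoin_eq_top hd ?_)
  obtain ⟨g, hs, hz⟩ := d.exists_map_eq hψ
  rintro _ ((rfl | rfl) | ⟨c, rfl⟩)
  · exact ⟨d.ζ, hψ.symm⟩
  · exact ⟨((g.right : ℤ) : M) * d.s, by rw [hs]; simp⟩
  · exact ⟨(d.χ (g.left.toAdd c) * d.z c) ^ (g.right : ℤ), by rw [hz]; simp⟩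

/-- The Galois group of `M` over `F(ζ)`. -/
def geom : Subgroup Gal(M/F) := MulAction.stabilizer Gal(M/F) d.ζ

theorem mem_geom {g : Gal(M/F)} : g ∈ d.geom ↔ g d.ζ = d.ζ := Iff.rfl

/-- The relation between an automorphism of `M` over `F(ζ)` and the element of the generalized
dihedral group that describes its action on the generators. -/
def ActsBy (g : Gal(M/F)) (h : GenDihedral p) : Prop :=
  g d.s = ((h.right : ℤ) : M) * d.s ∧
    ∀ c, g (d.z c) = (d.χ (h.left.toAdd c) * d.z c) ^ (h.right : ℤ)

theorem map_χ {g : Gal(M/F)} (hg : g ∈ d.geom) (j : ZMod p) : g (d.χ j) = d.χ j := by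
  rw [χ_apply, map_pow, d.mem_geom.1 hg]

theorem exists_actsBy {g : Gal(M/F)} (hg : g ∈ d.geom) : ∃ h, d.ActsBy g h :=
  d.exists_map_eq (ψ := (g : M →ₐ[F] M)) (ι := AlgHom.id F M) (d.mem_geom.1 hg)

theorem ActsBy.unique [CharZero M] {g : Gal(M/F)} {h h' : GenDihedral p} (H : d.ActsBy g h)
    (H' : d.ActsBy g h') : h = h' := by
  have hr : h.right = h'.right := by
    have := mul_right_cancel₀ d.s_ne_zero (H.1.symm.trans H'.1)
    exact Units.ext (Int.cast_injective this)
  refine SemidirectProduct.ext ?_ hr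
  apply Multiplicative.toAdd.injective
  funext c
  have h1 := (H.2 c).symm.trans (H'.2 c)
  rw [hr] at h1
  have h2 := congrArg (fun x => x ^ ((h'.right : ℤˣ) : ℤ)) h1
  simp only [← zpow_mul, Int.units_coe_mul_self, zpow_one] at h2
  exact d.χ_injective (mul_right_cancel₀ (d.z_ne_zero c) h2)

theorem ActsBy.mul {g g' : Gal(M/F)} (hg : g ∈ d.geom) {h h' : GenDihedral p}
    (H : d.ActsBy g h) (H' : d.ActsBy g' h') : d.ActsBy (g * g') (h * h') := by
  constructor
  · rw [AlgEquiv.mul_apply, H'.1, map_mul, map_intCast, H.1, SemidirectProduct.mul_right,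
      Units.val_mul, Int.cast_mul]
    ring
  · intro c
    rw [AlgEquiv.mul_apply, H'.2, map_zpow₀, map_mul, d.map_χ hg, H.2,
      GenDihedral.toAdd_mul_left, SemidirectProduct.mul_right, Units.val_mul, zpow_mul]
    congr 1
    rw [Pi.add_apply, Pi.smul_apply, AddChar.map_add_eq_mul, AddChar.map_zsmul_eq_zpow,
      mul_zpow, mul_zpow, mul_zpow, ← zpow_mul, Int.units_coe_mul_self, zpow_one]
    ring

/-- The action of the Galois group of `M` over `F(ζ)` on the Kummer generators. -/
noncomputable def geomHom [CharZero M] : d.geom →* GenDihedral p :=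
  MonoidHom.mk' (fun g => (d.exists_actsBy g.2).choose) fun g g' =>
    ActsBy.unique d (d.exists_actsBy (g * g').2).choose_spec
      (ActsBy.mul d g.2 (d.exists_actsBy g.2).choose_spec (d.exists_actsBy g'.2).choose_spec)

theorem geomHom_spec [CharZero M] (g : d.geom) : d.ActsBy g (d.geomHom g) :=
  (d.exists_actsBy g.2).choose_spec

theorem geomHom_injective [CharZero M] (hd : adjoin F d.gens = ⊤) :
    Function.Injective d.geomHom := by
  rw [injective_iff_map_eq_one]
  intro g hg
  have H := d.geomHom_spec g
  rw [hg] at H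
  refine Subtype.ext (d.algEquiv_ext hd (d.mem_geom.1 g.2) ?_ fun c => ?_)
  · simpa using H.1
  · simpa using H.2 c

theorem fixingSubgroup_adjoin_ζ : F⟮d.ζ⟯.fixingSubgroup = d.geom := by
  ext g
  rw [IntermediateField.mem_fixingSubgroup_iff, mem_geom]
  refine ⟨fun h => h _ d.ζ_mem, fun h => ?_⟩
  exact AlgHom.eqOn_adjoin_of_eqOn (f := (g : M →ₐ[F] M)) (g := AlgHom.id F M) (by simpa using h)

theorem exists_geom_map_s [CharZero F] [FiniteDimensional F M] [IsGalois F M] :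
    ∃ g ∈ d.geom, g d.s = -d.s := by
  by_contra! h
  apply d.s_notMem
  rw [← IsGalois.fixedField_fixingSubgroup F⟮d.ζ⟯, fixingSubgroup_adjoin_ζ, mem_fixedField_iff]
  intro g hg
  obtain ⟨ε, hε⟩ := d.exists_sign (g : M →ₐ[F] M) (AlgHom.id F M)
  rcases Int.units_eq_one_or ε with rfl | rfl
  · simpa using hε
  · exact absurd (by simpa using hε) (h g hg)

/-- The translations `v` that describe an automorphism of `M` over `F(ζ, s)`. -/
noncomputable def translations [CharZero M] : Submodule (ZMod p) (Fin 2 → ZMod p) :=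
  AddSubgroup.toZModSubmodule p
    (Subgroup.toAddSubgroup' (d.geomHom.range.comap SemidirectProduct.inl))

theorem mem_translations [CharZero M] {v : Fin 2 → ZMod p} : v ∈ d.translations ↔
    ∃ g, d.geomHom g = SemidirectProduct.inl (Multiplicative.ofAdd v) := Iff.rfl

/-- The Kummer extension has full degree `p ^ 2` over `F(ζ, s)`: otherwise a nontrivial monomial in
the generators is fixed by the Galois group over `F(ζ, s)`, contradicting their independence. -/
theorem translations_eq_top [CharZero M] [FiniteDimensional F M] [IsGalois F M] :
    d.translations = ⊤ := by
  by_contra hne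
  obtain ⟨f, hf0, hf⟩ := Submodule.exists_le_ker_of_lt_top _ (lt_top_iff_ne_top.2 hne)
  set m : Fin 2 → ZMod p := fun c => f (Pi.single c 1) with hm
  have hfm : ∀ v, f v = ∑ c, v c * m c := fun v => by
    rw [LinearMap.pi_apply_eq_sum_univ f v]
    refine Finset.sum_congr rfl fun c _ => ?_
    rw [smul_eq_mul, hm]
    congr 2
    ext j
    simp [Pi.single_apply, eq_comm]
  have hU : ∏ c, d.z c ^ (m c).val ∈ adjoin F {d.ζ, d.s} := by
    rw [← IsGalois.fixedField_fixingSubgroup (adjoin F {d.ζ, d.s}), mem_fixedField_iff]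
    intro g hg
    rw [IntermediateField.mem_fixingSubgroup_iff] at hg
    have hgζ : g ∈ d.geom := hg _ (subset_adjoin F _ (Or.inl rfl))
    have hgs : g d.s = d.s := hg _ (subset_adjoin F _ (Or.inr rfl))
    have H := d.geomHom_spec ⟨g, hgζ⟩
    set h := d.geomHom ⟨g, hgζ⟩ with hh
    have hr : h.right = 1 := by
      have h1 := H.1
      rw [hgs] at h1
      have h2 := (mul_eq_right₀ d.s_ne_zero).1 h1.symm
      exact Units.ext (Int.cast_injective (α := M) (by rw [h2]; simp))
    have hv : f h.left.toAdd = 0 :=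
      hf (d.mem_translations.2 ⟨⟨g, hgζ⟩, SemidirectProduct.ext rfl hr⟩)
    have hz : ∀ c, g (d.z c) = d.χ (h.left.toAdd c) * d.z c := fun c => by
      have := H.2 c
      rwa [hr, Units.val_one, zpow_one] at this
    rw [map_prod]
    simp only [map_pow, hz, mul_pow, ← AddChar.map_nsmul_eq_pow, Finset.prod_mul_distrib]
    rw [Fin.prod_univ_two, ← AddChar.map_add_eq_mul, ← Fin.sum_univ_two fun c =>
      (m c).val • h.left.toAdd c]
    have : ∑ c, (m c).val • h.left.toAdd c = 0 := by
      rw [← hv, hfm]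
      refine Finset.sum_congr rfl fun c _ => ?_
      rw [nsmul_eq_mul, ZMod.natCast_zmod_val, mul_comm]
    rw [this, AddChar.map_zero_eq_one, one_mul]
  have hind := d.independent (fun c => (m c).val) _ hU (by
    rw [← Finset.prod_pow]
    exact Finset.prod_congr rfl fun c _ => pow_right_comm _ _ _)
  apply hf0
  ext v
  have hm0 : ∀ c, m c = 0 := fun c => by
    have := Nat.eq_zero_of_dvd_of_lt (hind c) (ZMod.val_lt _)
    rwa [ZMod.val_eq_zero] at this
  simpa [hm] using hm0 v

theorem geomHom_surjective [CharZero F] [CharZero M] [FiniteDimensional F M] [IsGalois F M] :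
    Function.Surjective d.geomHom := by
  have hinl : ∀ n, SemidirectProduct.inl n ∈ d.geomHom.range := fun n =>
    d.mem_translations.1 (d.translations_eq_top ▸ Submodule.mem_top : n.toAdd ∈ d.translations)
  -- the range contains all translations; any element acting as `s ↦ -s` yields the other coset
  obtain ⟨g, hg, hgs⟩ := d.exists_geom_map_s
  have hr : (d.geomHom ⟨g, hg⟩).right = -1 := by
    have H := (d.geomHom_spec ⟨g, hg⟩).1
    rw [hgs, neg_eq_neg_one_mul] at H
    have := mul_right_cancel₀ d.s_ne_zero H
    exact Units.ext (Int.cast_injective (α := M) (by rw [← this]; simp))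
  intro h
  change h ∈ d.geomHom.range
  rcases Int.units_eq_one_or h.right with h1 | h1
  · have : h = SemidirectProduct.inl h.left := SemidirectProduct.ext rfl h1
    rw [this]
    exact hinl _
  · have : h = SemidirectProduct.inl (h.left * (d.geomHom ⟨g, hg⟩).left⁻¹) *
        d.geomHom ⟨g, hg⟩ := by
      refine SemidirectProduct.ext ?_ ?_
      · simp
      · simp [h1, hr]
    rw [this]
    exact mul_mem (hinl _) ⟨_, rfl⟩

theorem map_y_inv {g : Gal(M/F)} (hg : g ∈ d.geom) {h : GenDihedral p} (H : d.ActsBy g h)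
    (c : Fin 2) (a : (ZMod p)ˣ) : g (d.y c a) = d.y c a ^ (h.right : ℤ) :=
  d.map_y (ψ := (g : M →ₐ[F] M)) (ι := AlgHom.id F M) (d.mem_geom.1 hg) H.1 c a

theorem D_z' (b : (ZMod p)ˣ) (c : Fin 2) : d.D b (d.z c) = d.z c ^ b.val.val /
    ∏ a : (ZMod p)ˣ, d.y c a⁻¹ ^ (a.val.val * b.val.val / p) := by
  rw [eq_div_iff (Finset.prod_ne_zero_iff.2 fun a _ => pow_ne_zero _ (d.y_ne_zero c a⁻¹))]
  exact d.D_z b c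

theorem D_commute (hd : adjoin F d.gens = ⊤) {g : Gal(M/F)} (hg : g ∈ d.geom)
    (b : (ZMod p)ˣ) : Commute g (d.D b) := by
  obtain ⟨h, H⟩ := d.exists_actsBy hg
  refine d.algEquiv_ext hd ?_ ?_ fun c => ?_
  · rw [AlgEquiv.mul_apply, AlgEquiv.mul_apply, d.mem_geom.1 hg, d.D_ζ, map_pow,
      d.mem_geom.1 hg]
  · rw [AlgEquiv.mul_apply, AlgEquiv.mul_apply, H.1, d.D_s, map_mul, map_intCast, d.D_s, H.1]
  · rw [AlgEquiv.mul_apply, AlgEquiv.mul_apply, H.2, map_zpow₀, map_mul, χ_apply, map_pow, d.D_ζ,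
      d.D_z', map_div₀, map_pow, map_prod, H.2]
    simp only [map_pow, d.map_y_inv hg H]
    rw [← pow_mul, mul_comm b.val.val, pow_mul, ← χ_apply, ← mul_div_assoc, ← mul_pow, div_zpow,
      ← Finset.prod_zpow]
    congr 1
    · rw [zpow_pow_comm]
    · exact Finset.prod_congr rfl fun a _ => zpow_pow_comm _ _ _

theorem D_eq_one_of_mem_geom {b : (ZMod p)ˣ} (h : d.D b ∈ d.geom) : b = 1 := by
  rw [mem_geom, D_ζ, ← χ_apply] at h
  have h1 : d.χ 1 = d.ζ := by
    rw [χ_apply, ZMod.val_one, pow_one]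
  exact Units.ext (d.χ_injective (h.trans h1.symm))

theorem exists_mul_D (g : Gal(M/F)) : ∃ b, ∃ c ∈ d.geom, g = d.D b * c := by
  obtain ⟨b, hb⟩ := d.exists_map_ζ_eq (g : M →ₐ[F] M) (AlgHom.id F M)
  refine ⟨b, (d.D b)⁻¹ * g, ?_, by rw [mul_inv_cancel_left]⟩
  change (d.D b)⁻¹ (g d.ζ) = d.ζ
  have hb' : g d.ζ = d.D b d.ζ := hb
  rw [hb', ← AlgEquiv.mul_apply, inv_mul_cancel, AlgEquiv.one_apply]

theorem range_D_normal (hd : adjoin F d.gens = ⊤) : d.D.range.Normal := by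
  refine ⟨?_⟩
  rintro _ ⟨a, rfl⟩ g
  obtain ⟨b, c, hc, rfl⟩ := d.exists_mul_D g
  refine ⟨b * a * b⁻¹, ?_⟩
  rw [map_mul, map_mul, map_inv, mul_inv_rev, mul_assoc (d.D b) c, (d.D_commute hd hc a).eq]
  group

/-- The fixed field of the lifts `D b` is Galois over `F` with generalized dihedral group: the
group of these lifts is a complement of the Galois group over `F(ζ)` and commutes with it. -/
theorem exists_gal_equiv [CharZero F] (hd : adjoin F d.gens = ⊤) : ∃ E : IntermediateField F M,
    FiniteDimensional F E ∧ IsGalois F E ∧ Nonempty (Gal(E/F) ≃* GenDihedral p) ∧ d.s ∈ E ∧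
      ∀ x ∈ E, ∀ b, d.D b x = x := by
  have : CharZero M := charZero_of_injective_algebraMap (algebraMap F M).injective
  have := d.finiteDimensional hd
  have := d.normal hd
  have : IsGalois F M := { }
  have := d.range_D_normal hd
  refine ⟨fixedField d.D.range, inferInstance, inferInstance, ⟨?_⟩, ?_, ?_⟩
  · let e₁ : d.geom ≃* GenDihedral p :=
      MulEquiv.ofBijective d.geomHom ⟨d.geomHom_injective hd, d.geomHom_surjective⟩
    let q : d.geom →* Gal(M/F) ⧸ d.D.range := (QuotientGroup.mk' d.D.range).comp d.geom.subtype
    have hq : Function.Bijective q := by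
      constructor
      · rw [injective_iff_map_eq_one]
        rintro ⟨c, hc⟩ h
        obtain ⟨b, rfl⟩ := (QuotientGroup.eq_one_iff c).1 h
        have hb := d.D_eq_one_of_mem_geom hc
        subst hb
        exact Subtype.ext (map_one d.D)
      · intro x
        obtain ⟨g, rfl⟩ := QuotientGroup.mk_surjective x
        obtain ⟨b, c, hc, rfl⟩ := d.exists_mul_D g
        refine ⟨⟨c, hc⟩, QuotientGroup.eq.2 ?_⟩
        change c⁻¹ * (d.D b * c) ∈ _
        rw [← (d.D_commute hd hc b).eq, inv_mul_cancel_left]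
        exact ⟨b, rfl⟩
    exact (IsGalois.normalAutEquivQuotient d.D.range).symm.trans
      ((MulEquiv.ofBijective q hq).symm.trans e₁)
  · rw [mem_fixedField_iff]
    rintro _ ⟨b, rfl⟩
    exact d.D_s b
  · intro x hx b
    exact (mem_fixedField_iff _ x).1 hx _ ⟨b, rfl⟩

end DihedralKummerData

/-! ### Restriction of the data to the field they generate -/

namespace DihedralKummerData

variable {p : ℕ} [Fact p.Prime] {F L : Type*} [Field F] [Field L] [Algebra F L]

/-- The data can be given by `p`-th roots `w c` of `(t c ζ s + 1) / (t c ζ s - 1)`, on putting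
`z c = ∏ a, (D a⁻¹ (w c)) ^ a`. -/
noncomputable def ofRoots (D : (ZMod p)ˣ →* Gal(L/F)) (ζ s : L) (t : Fin 2 → F) (w : Fin 2 → L)
    (isPrimitiveRoot : IsPrimitiveRoot ζ p) (s_sq : ∃ T : F, s ^ 2 = algebraMap F L T)
    (D_ζ : ∀ b, D b ζ = ζ ^ b.val.val) (D_s : ∀ b, D b s = s)
    (w_pow : ∀ c, w c ^ p =
      (algebraMap F L (t c) * ζ * s + 1) / (algebraMap F L (t c) * ζ * s - 1))
    (s_notMem : s ∉ F⟮ζ⟯)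
    (independent : ∀ m : Fin 2 → ℕ, ∀ u ∈ adjoin F {ζ, s},
      ∏ c, (∏ a : (ZMod p)ˣ,
        ((algebraMap F L (t c) * ζ ^ (a⁻¹ : (ZMod p)ˣ).val.val * s + 1) /
          (algebraMap F L (t c) * ζ ^ (a⁻¹ : (ZMod p)ˣ).val.val * s - 1)) ^ a.val.val) ^ m c =
        u ^ p → ∀ c, p ∣ m c) : DihedralKummerData p F L :=
  have hw : ∀ (a : (ZMod p)ˣ) c, D a (w c) ^ p =
      (algebraMap F L (t c) * ζ ^ a.val.val * s + 1) /
        (algebraMap F L (t c) * ζ ^ a.val.val * s - 1) := fun a c => by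
    rw [← map_pow, w_pow, map_div₀, map_add, map_sub, map_mul, map_mul, map_one, D_ζ, D_s,
      AlgEquiv.commutes]
  have hz : ∀ c, (∏ a : (ZMod p)ˣ, D a⁻¹ (w c) ^ a.val.val) ^ p = ∏ a : (ZMod p)ˣ,
      ((algebraMap F L (t c) * ζ ^ (a⁻¹ : (ZMod p)ˣ).val.val * s + 1) /
        (algebraMap F L (t c) * ζ ^ (a⁻¹ : (ZMod p)ˣ).val.val * s - 1)) ^ a.val.val := fun c => by
    rw [← Finset.prod_pow]
    refine Finset.prod_congr rfl fun a _ => ?_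
    rw [← hw, pow_right_comm]
  { D := D
    ζ := ζ
    s := s
    t := t
    z := fun c => ∏ a : (ZMod p)ˣ, D a⁻¹ (w c) ^ a.val.val
    isPrimitiveRoot := isPrimitiveRoot
    s_sq := s_sq
    D_ζ := D_ζ
    D_s := D_s
    s_notMem := s_notMem
    z_pow := hz
    D_z := fun b c => by
      have h1 : D b (∏ a : (ZMod p)ˣ, D a⁻¹ (w c) ^ a.val.val) =
          ∏ a : (ZMod p)ˣ, D a⁻¹ (w c) ^ (b * a).val.val := by
        rw [map_prod, ← Equiv.prod_comp (Equiv.mulLeft b)]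
        refine Finset.prod_congr rfl fun a _ => ?_
        rw [Equiv.coe_mulLeft, map_pow, ← AlgEquiv.mul_apply, ← map_mul, mul_inv_rev, mul_comm a⁻¹,
          mul_inv_cancel_left]
      rw [h1, ← Finset.prod_mul_distrib, ← Finset.prod_pow]
      refine Finset.prod_congr rfl fun a _ => ?_
      rw [← hw, ← pow_mul, ← pow_add, ← pow_mul, Units.val_mul, mul_comm b.val, ZMod.val_mul,
        Nat.mod_add_div]
    independent := fun m u hu h => independent m u hu (by simpa only [hz] using h) }

variable (d : DihedralKummerData p F L)

theorem D_mem (b : (ZMod p)ˣ) {x : L} (hx : x ∈ adjoin F d.gens) :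
    d.D b x ∈ adjoin F d.gens := by
  have hle : adjoin F d.gens ≤ (adjoin F d.gens).comap (d.D b : L →ₐ[F] L) := by
    have hζ := subset_adjoin F _ d.ζ_mem_gens
    have hs := subset_adjoin F _ d.s_mem_gens
    rw [adjoin_le_iff]
    rintro _ ((rfl | rfl) | ⟨c, rfl⟩)
    · change d.D b d.ζ ∈ adjoin F d.gens
      rw [d.D_ζ]
      exact pow_mem hζ _
    · change d.D b d.s ∈ adjoin F d.gens
      rwa [d.D_s]
    · change d.D b (d.z c) ∈ adjoin F d.gens
      rw [d.D_z']
      have hy : ∀ c a, d.y c a ∈ adjoin F d.gens := fun c a => by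
        have h1 := mul_mem (mul_mem (IntermediateField.algebraMap_mem _ (d.t c))
          (pow_mem hζ a.val.val)) hs
        exact div_mem (add_mem h1 (one_mem _)) (sub_mem h1 (one_mem _))
      exact div_mem (pow_mem (subset_adjoin F _ (d.z_mem_gens c)) _)
        (prod_mem fun a _ => pow_mem (hy c a⁻¹) _)
  exact hle hx

/-- The lifts `D b`, restricted to the field generated by the data. -/
noncomputable def restrictD : (ZMod p)ˣ →* Gal(adjoin F d.gens/F) :=
  let r : (ZMod p)ˣ → (adjoin F d.gens →ₐ[F] adjoin F d.gens) := fun b =>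
    ((d.D b : L →ₐ[F] L).comp (adjoin F d.gens).val).codRestrict (adjoin F d.gens).toSubalgebra
      fun x => d.D_mem b x.2
  have hr : ∀ a b, a * b = 1 → (r a).comp (r b) = AlgHom.id F _ := fun a b h => by
    ext x
    change d.D a (d.D b x) = x
    rw [← AlgEquiv.mul_apply, ← map_mul, h, map_one, AlgEquiv.one_apply]
  { toFun := fun b => AlgEquiv.ofAlgHom (r b) (r b⁻¹) (hr _ _ (mul_inv_cancel b))
      (hr _ _ (inv_mul_cancel b))
    map_one' := by
      ext x
      change d.D 1 x = x
      rw [map_one, AlgEquiv.one_apply]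
    map_mul' := fun a b => by
      ext x
      change d.D (a * b) x = d.D a (d.D b x)
      rw [map_mul, AlgEquiv.mul_apply] }

/-- The data, restricted to the field they generate. -/
noncomputable def restrict : DihedralKummerData p F (adjoin F d.gens) where
  D := d.restrictD
  ζ := ⟨d.ζ, subset_adjoin F _ d.ζ_mem_gens⟩
  s := ⟨d.s, subset_adjoin F _ d.s_mem_gens⟩
  t := d.t
  z c := ⟨d.z c, subset_adjoin F _ (d.z_mem_gens c)⟩
  isPrimitiveRoot := IsPrimitiveRoot.of_map_of_injective (f := (adjoin F d.gens).val)
    d.isPrimitiveRoot (adjoin F d.gens).val.injective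
  s_sq := by
    obtain ⟨T, hT⟩ := d.s_sq
    exact ⟨T, Subtype.ext hT⟩
  z_pow c := by
    apply (adjoin F d.gens).val.injective
    simp only [map_pow, map_prod, map_div₀, map_add, map_sub, map_mul, map_one]
    exact d.z_pow c
  D_ζ b := Subtype.ext (d.D_ζ b)
  D_s b := Subtype.ext (d.D_s b)
  D_z b c := by
    apply (adjoin F d.gens).val.injective
    simp only [map_pow, map_prod, map_div₀, map_add, map_sub, map_mul, map_one]
    exact d.D_z b c
  s_notMem h := by
    apply d.s_notMem
    have := (mem_map (f := (adjoin F d.gens).val) _).2 ⟨_, h, rfl⟩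
    rwa [adjoin_map, Set.image_singleton] at this
  independent m u hu h := by
    refine d.independent m u ?_ ?_
    · have := (mem_map (f := (adjoin F d.gens).val) _).2 ⟨_, hu, rfl⟩
      rwa [adjoin_map, Set.image_pair] at this
    · have := congrArg (adjoin F d.gens).val h
      simp only [map_pow, map_prod] at this
      exact this

theorem adjoin_restrict_gens : adjoin F d.restrict.gens = ⊤ := by
  apply map_injective (adjoin F d.gens).val
  rw [adjoin_map, ← AlgHom.fieldRange_eq_map, fieldRange_val]
  congr 1
  change _ '' ({_, _} ∪ Set.range _) = {_, _} ∪ Set.range _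
  rw [Set.image_union, Set.image_pair, ← Set.range_comp]
  rfl

/-- Kummer data yield a Galois extension of `F` with generalized dihedral group inside the field
fixed by the lifts `D b`. -/
theorem exists_extension [CharZero F] : ∃ (E : IntermediateField F L),
    FiniteDimensional F E ∧ IsGalois F E ∧ Nonempty (Gal(E/F) ≃* GenDihedral p) ∧ d.s ∈ E ∧
      ∀ x ∈ E, ∀ b, d.D b x = x := by
  obtain ⟨E, hfin, hgal, ⟨e⟩, hs, hD⟩ := d.restrict.exists_gal_equiv d.adjoin_restrict_gens
  let f : E ≃ₐ[F] lift E := liftAlgEquiv E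
  refine ⟨lift E, Module.Finite.equiv f.toLinearEquiv, IsGalois.of_algEquiv f,
    ⟨f.symm.autCongr.trans e⟩, ?_, ?_⟩
  · exact (mem_lift _).2 hs
  · intro x hx b
    have hx' := lift_le E hx
    have := hD ⟨x, hx'⟩ ((mem_lift ⟨x, hx'⟩).1 hx) b
    exact congrArg Subtype.val this

end DihedralKummerData

end KummerDescent

/-! ### Independence of the radicands modulo `p`-th powers -/

section Independence

open Polynomial IsDedekindDomain

variable {K : Type*} [Field K]

/-- The quadratic polynomial `1 + β X - X ^ 2`. -/
noncomputable def quad (β : K) : K[X] := C β * X + (1 - X ^ 2)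

theorem natDegree_quad (β : K) : (quad β).natDegree = 2 := by
  unfold quad
  compute_degree!

theorem quad_ne_zero (β : K) : quad β ≠ 0 := fun h => by
  have := natDegree_quad β
  rw [h, natDegree_zero] at this
  omega

theorem not_dvd_quad_of_ne {q : K[X]} (hq : Irreducible q) {β β' : K} (hne : β' ≠ β)
    (h : q ∣ quad β) : ¬ q ∣ quad β' := by
  intro h'
  have h1 : q ∣ C (β' - β) * X := by
    have : C (β' - β) * X = quad β' - quad β := by
      simp only [quad, C_sub]; ring
    rw [this]
    exact dvd_sub h' h
  have hu : IsUnit (C (β' - β)) := isUnit_C.2 (sub_ne_zero.2 hne).isUnit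
  have h2 : q ∣ X := (hu.dvd_mul_left).1 h1
  have h3 : q ∣ 1 := by
    have : (1 : K[X]) = quad β - X * (C β - X) := by
      simp only [quad]; ring
    rw [this]
    exact dvd_sub h (h2.mul_right _)
  exact hq.not_isUnit (isUnit_of_dvd_one h3)

/-- There is a valuation of `K(X)` that is trivial on all `quad β'` except for `β' = β`, where its
value is `-1` or `-2`. -/
theorem exists_valuation_quad (β : K) : ∃ v : Valuation (RatFunc K) (WithZero (Multiplicative ℤ)),
    (∃ e : ℤ, (e = 1 ∨ e = 2) ∧ v (algebraMap K[X] (RatFunc K) (quad β)) = WithZero.exp (-e)) ∧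
      ∀ β' ≠ β, v (algebraMap K[X] (RatFunc K) (quad β')) = 1 := by
  obtain ⟨q, hq, hdvd⟩ := exists_irreducible_of_natDegree_pos (f := quad β)
    (by rw [natDegree_quad]; exact two_pos)
  let w : HeightOneSpectrum K[X] := ⟨Ideal.span {q},
    (Ideal.span_singleton_prime hq.ne_zero).2 hq.prime, by simpa using hq.ne_zero⟩
  have hlt : ∀ r : K[X], w.valuation (RatFunc K) (algebraMap K[X] (RatFunc K) r) < 1 ↔ q ∣ r :=
    fun r => by
      rw [w.valuation_lt_one_iff_dvd, Ideal.dvd_span_singleton, Ideal.mem_span_singleton]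
  refine ⟨w.valuation (RatFunc K), ?_, fun β' hne => ?_⟩
  · obtain ⟨n, hn⟩ : ∃ n : ℕ, w.valuation (RatFunc K) (algebraMap K[X] (RatFunc K) (quad β)) =
        WithZero.exp (-(n : ℤ)) := by
      rw [w.valuation_of_algebraMap, w.intValuation_if_neg (quad_ne_zero β)]
      exact ⟨_, rfl⟩
    have h1 := (hlt _).2 hdvd
    rw [hn, ← WithZero.exp_zero, WithZero.exp_lt_exp] at h1
    have h2 : n ≤ 2 := by
      have h3 : w.intValuation (quad β) ≤ WithZero.exp (-(n : ℤ)) := by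
        rw [← w.valuation_of_algebraMap (K := RatFunc K), hn]
      rw [w.intValuation_le_pow_iff_dvd, Ideal.dvd_span_singleton, Ideal.span_singleton_pow,
        Ideal.mem_span_singleton] at h3
      have h4 := natDegree_le_of_dvd h3 (quad_ne_zero β)
      rw [natDegree_pow, natDegree_quad] at h4
      exact (Nat.le_mul_of_pos_right n hq.natDegree_pos).trans h4
    exact ⟨n, by omega, hn⟩
  · refine le_antisymm (w.valuation_le_one _) (not_lt.1 fun h => ?_)
    exact not_dvd_quad_of_ne hq hne hdvd ((hlt _).1 h)

variable {p : ℕ} [Fact p.Prime] {ζ : K}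

theorem natCast_mul_zeta_pow_ne_neg [CharZero K] (hp : p ≠ 2) (hζ : IsPrimitiveRoot ζ p) (c : ℕ)
    (hc : c ≠ 0) (c' i : ℕ) : -((c' : K) * ζ ^ i) ≠ c * ζ := by
  intro h
  have hodd : Odd p := (Fact.out : p.Prime).odd_of_ne_two hp
  have h1 := congrArg (fun x => x ^ p) h
  simp only [hodd.neg_pow, mul_pow, ← pow_mul] at h1
  rw [mul_comm i, pow_mul, hζ.pow_eq_one, one_pow, mul_one, mul_one] at h1
  have h2 : ((c' ^ p + c ^ p : ℕ) : K) = 0 := by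
    push_cast
    linear_combination -h1
  rw [Nat.cast_eq_zero] at h2
  have := pow_pos (Nat.pos_of_ne_zero hc) p
  omega

theorem natCast_mul_zeta_pow_eq [CharZero K] (hζ : IsPrimitiveRoot ζ p) {c c' : ℕ} (hc : c ≠ 0)
    {i : ℕ} (hi : i < p) (h : (c' : K) * ζ ^ i = c * ζ) : c' = c ∧ i = 1 := by
  have hpp : p.Prime := Fact.out
  have h1 := congrArg (fun x => x ^ p) h
  simp only [mul_pow, ← pow_mul] at h1
  rw [mul_comm i, pow_mul, hζ.pow_eq_one, one_pow, mul_one, mul_one] at h1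
  have h2 : c' = c := Nat.pow_left_injective hpp.ne_zero (by exact_mod_cast h1)
  subst h2
  have h3 := mul_left_cancel₀ (Nat.cast_ne_zero.2 hc) h
  exact ⟨rfl, hζ.pow_inj hi hpp.one_lt (by rw [h3, pow_one])⟩

/-- The radicands are independent modulo `p`-th powers: for each `c` there is a place that occurs
with multiplicity `1` or `2` in the radicand with index `c`, and does not occur in the other. -/
theorem dvd_of_prod_quad_eq_pow [CharZero K] (hp : p ≠ 2) (hζ : IsPrimitiveRoot ζ p)
    (m : Fin 2 → ℕ) (U : RatFunc K)
    (h : ∏ c : Fin 2, (∏ a : (ZMod p)ˣ,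
      (algebraMap K[X] (RatFunc K) (quad (((c.val + 1 : ℕ) : K) * ζ ^ (a⁻¹ : (ZMod p)ˣ).val.val)) /
        -algebraMap K[X] (RatFunc K)
          (quad (-(((c.val + 1 : ℕ) : K) * ζ ^ (a⁻¹ : (ZMod p)ˣ).val.val)))) ^ a.val.val) ^ m c =
      U ^ p) (c : Fin 2) : p ∣ m c := by
  have hpp : p.Prime := Fact.out
  -- only the factor with index `c` and `a = 1` has nontrivial value, and its exponent is `m c`
  obtain ⟨v, ⟨e, he, hve⟩, hv⟩ := exists_valuation_quad (((c.val + 1 : ℕ) : K) * ζ)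
  have hval : ∀ (c' : Fin 2) (a : (ZMod p)ˣ), (c' ≠ c ∨ a ≠ 1) →
      v (algebraMap K[X] (RatFunc K)
        (quad (((c'.val + 1 : ℕ) : K) * ζ ^ (a⁻¹ : (ZMod p)ˣ).val.val))) = 1 := by
    intro c' a hne
    refine hv _ fun heq => ?_
    obtain ⟨h1, h2⟩ := natCast_mul_zeta_pow_eq hζ (Nat.succ_ne_zero _) (ZMod.val_lt _) heq
    rcases hne with hne | hne
    · exact hne (Fin.ext (by omega))
    · apply hne
      rw [← inv_eq_one]
      refine Units.ext (ZMod.val_injective p ?_)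
      rw [h2, Units.val_one, ZMod.val_one]
  have hfac : ∀ (c' : Fin 2) (a : (ZMod p)ˣ), v ((algebraMap K[X] (RatFunc K)
      (quad (((c'.val + 1 : ℕ) : K) * ζ ^ (a⁻¹ : (ZMod p)ˣ).val.val)) /
        -algebraMap K[X] (RatFunc K)
          (quad (-(((c'.val + 1 : ℕ) : K) * ζ ^ (a⁻¹ : (ZMod p)ˣ).val.val)))) ^ a.val.val) =
      v (algebraMap K[X] (RatFunc K)
      (quad (((c'.val + 1 : ℕ) : K) * ζ ^ (a⁻¹ : (ZMod p)ˣ).val.val))) ^ a.val.val := by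
    intro c' a
    rw [map_pow, map_div₀, Valuation.map_neg,
      hv _ (natCast_mul_zeta_pow_ne_neg hp hζ _ (Nat.succ_ne_zero _) _ _), div_one]
  have h1 := congrArg v h
  simp only [map_prod, map_pow] at h1
  rw [Finset.prod_eq_single c, Finset.prod_eq_single 1] at h1
  · have h2 := hfac c 1
    rw [map_pow] at h2
    rw [h2, inv_one, Units.val_one, ZMod.val_one, pow_one, pow_one, hve] at h1
    have hU : v U ≠ 0 := by
      intro hU
      rw [hU, zero_pow hpp.ne_zero] at h1
      exact pow_ne_zero _ WithZero.exp_ne_zero h1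
    rw [← WithZero.exp_log hU, ← WithZero.exp_nsmul, ← WithZero.exp_nsmul,
      WithZero.exp_inj] at h1
    have h3 : (p : ℤ) ∣ m c * e := by
      refine ⟨-(v U).log, ?_⟩
      simp only [nsmul_eq_mul] at h1
      linear_combination -h1
    rcases (Nat.prime_iff_prime_int.1 hpp).dvd_or_dvd h3 with h4 | h4
    · exact_mod_cast h4
    · exfalso
      have h5 := Int.le_of_dvd (by omega) h4
      have h6 := hpp.two_le
      omega
  · intro a _ ha
    have h2 := hfac c a
    rw [map_pow] at h2
    rw [h2, hval c a (Or.inr ha), one_pow]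
  · exact fun h => absurd (Finset.mem_univ _) h
  · intro c' _ hc'
    rw [Finset.prod_eq_one, one_pow]
    intro a _
    have h2 := hfac c' a
    rw [map_pow] at h2
    rw [h2, hval c' a (Or.inl hc'), one_pow]
  · exact fun h => absurd (Finset.mem_univ _) h

end Independence

/-! ### The double cover and its Laurent expansions -/

section DoubleCover

open scoped PowerSeries LaurentSeries

section PowerSeriesRoots

variable {K : Type*} [Field K] [CharZero K]

/-- A power series with constant coefficient `1` over a field of characteristic zero has an `n`-th
root, by Hensel's lemma. -/
theorem PowerSeries.exists_pow_eq {n : ℕ} (hn : n ≠ 0) {f : K⟦X⟧}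
    (hf : PowerSeries.constantCoeff f = 1) : ∃ g : K⟦X⟧, g ^ n = f := by
  have hmem : ∀ h : K⟦X⟧, h ∈ Ideal.span {(PowerSeries.X : K⟦X⟧)} ↔
      PowerSeries.constantCoeff h = 0 := fun h => by
    rw [Ideal.mem_span_singleton, PowerSeries.X_dvd_iff]
  obtain ⟨g, hg, -⟩ := HenselianRing.is_henselian (I := Ideal.span {(PowerSeries.X : K⟦X⟧)})
    (Polynomial.X ^ n - Polynomial.C f) (Polynomial.monic_X_pow_sub_C f hn) 1
    (by rw [hmem]; simp [hf])
    (by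
      have : (n : K⟦X⟧) = PowerSeries.C (n : K) := by simp
      refine IsUnit.map _ ?_
      simp only [Polynomial.derivative_sub, Polynomial.derivative_X_pow, Polynomial.derivative_C,
        sub_zero, Polynomial.eval_mul, Polynomial.eval_C, Polynomial.eval_pow, Polynomial.eval_X,
        one_pow, mul_one]
      rw [this]
      exact (Nat.cast_ne_zero.2 hn).isUnit.map _)
  refine ⟨g, ?_⟩
  have : g ^ n - f = 0 := by simpa [Polynomial.IsRoot] using hg
  exact sub_eq_zero.1 this

end PowerSeriesRoots

section Laurent

section

variable {K : Type*} [Field K]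

/-- The action of a ring endomorphism of `K` on the coefficients of Laurent series. -/
noncomputable def laurentMap (f : K →+* K) : K⸨X⸩ →+* K⸨X⸩ where
  toFun x := x.map f
  map_one' := by
    ext n
    simp only [HahnSeries.map_coeff, HahnSeries.coeff_one]
    split_ifs <;> simp
  map_zero' := by ext; simp
  map_mul' x y := HahnSeries.map_mul (f : K →ₙ+* K)
  map_add' x y := by ext; simp

theorem coeff_laurentMap (f : K →+* K) (x : K⸨X⸩) (n : ℤ) :
    (laurentMap f x).coeff n = f (x.coeff n) := rfl

theorem laurentMap_algebraMap (f : K →+* K) (g : K⟦X⟧) :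
    laurentMap f (algebraMap K⟦X⟧ K⸨X⸩ g) =
      algebraMap K⟦X⟧ K⸨X⸩ (PowerSeries.map f g) := by
  ext n
  rw [coeff_laurentMap, LaurentSeries.coe_algebraMap,
    PowerSeries.coeff_coe, PowerSeries.coeff_coe, PowerSeries.coeff_map]
  split_ifs <;> simp

end

variable (K : Type*) [Field K]

/-- The Laurent expansion at `X = 1` of rational functions. -/
noncomputable def expandAtOne : K⟮X⟯ →+* K⸨X⸩ :=
  IsFractionRing.lift (A := K[X]) (g := (algebraMap K⟦X⟧ K⸨X⸩).comp
    (Polynomial.coeToPowerSeries.ringHom.comp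
      (Polynomial.taylorAlgHom (1 : K) : K[X] →+* K[X])))
    ((IsFractionRing.injective K⟦X⟧ K⸨X⸩).comp
      ((Polynomial.coe_injective K).comp (Polynomial.taylor_injective 1)))

theorem expandAtOne_algebraMap (P : K[X]) : expandAtOne K (algebraMap K[X] K⟮X⟯ P) =
    algebraMap K⟦X⟧ K⸨X⸩ (Polynomial.taylor 1 P : K[X]) :=
  IsFractionRing.lift_algebraMap _ P

theorem expandAtOne_X : expandAtOne K (algebraMap K[X] K⟮X⟯ Polynomial.X) =
    algebraMap K⟦X⟧ K⸨X⸩ (1 + PowerSeries.X) := by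
  rw [expandAtOne_algebraMap, Polynomial.taylor_X]
  simp [add_comm]

theorem expandAtOne_C (a : K) : expandAtOne K (algebraMap K[X] K⟮X⟯ (Polynomial.C a)) =
    algebraMap K⟦X⟧ K⸨X⸩ (PowerSeries.C a) := by
  rw [expandAtOne_algebraMap, Polynomial.taylor_C, Polynomial.coe_C]

variable [CharZero K]

/-- The homomorphism `ℚ(X) → K(X)` that maps `X` to `X ^ 2`. -/
noncomputable def doubleCover : ℚ⟮X⟯ →+* K⟮X⟯ :=
  IsFractionRing.lift (A := ℚ[X]) (g := (algebraMap K[X] K⟮X⟯).comp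
    ((Polynomial.expand K 2 : K[X] →+* K[X]).comp (Polynomial.mapRingHom (algebraMap ℚ K))))
    ((IsFractionRing.injective K[X] K⟮X⟯).comp
      ((Polynomial.expand_injective two_pos).comp
        (Polynomial.map_injective _ (algebraMap ℚ K).injective)))

theorem doubleCover_algebraMap (P : ℚ[X]) : doubleCover K (algebraMap ℚ[X] ℚ⟮X⟯ P) =
    algebraMap K[X] K⟮X⟯ (Polynomial.expand K 2 (P.map (algebraMap ℚ K))) :=
  IsFractionRing.lift_algebraMap _ P

theorem doubleCover_X : doubleCover K (algebraMap ℚ[X] ℚ⟮X⟯ Polynomial.X) =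
    algebraMap K[X] K⟮X⟯ Polynomial.X ^ 2 := by
  rw [doubleCover_algebraMap, Polynomial.map_X, Polynomial.expand_X, map_pow]

/-- The field `K((X))` as an extension of `ℚ(X)`, through the Laurent expansion at `X = 1` of the
double cover `X ↦ X ^ 2`. -/
@[reducible] noncomputable def doubleCoverAlgebra : Algebra ℚ⟮X⟯ K⸨X⸩ :=
  ((expandAtOne K).comp (doubleCover K)).toAlgebra

attribute [local instance] doubleCoverAlgebra

theorem doubleCoverAlgebra_algebraMap (f : ℚ⟮X⟯) :
    algebraMap ℚ⟮X⟯ K⸨X⸩ f = expandAtOne K (doubleCover K f) := rfl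

theorem ratFunc_ringHom_ext {R : Type*} [Field R] {f g : ℚ⟮X⟯ →+* R}
    (h : f (algebraMap ℚ[X] ℚ⟮X⟯ Polynomial.X) = g (algebraMap ℚ[X] ℚ⟮X⟯ Polynomial.X)) :
    f = g := by
  apply IsLocalization.ringHom_ext (nonZeroDivisors ℚ[X])
  exact Polynomial.ringHom_ext' (Subsingleton.elim _ _) h

variable {K}

theorem laurentMap_comp_algebraMap (f : K →+* K) :
    (laurentMap f).comp (algebraMap ℚ⟮X⟯ K⸨X⸩) = algebraMap ℚ⟮X⟯ K⸨X⸩ := by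
  apply ratFunc_ringHom_ext
  rw [RingHom.comp_apply, doubleCoverAlgebra_algebraMap, doubleCover_X, map_pow, map_pow,
    expandAtOne_X, laurentMap_algebraMap, map_add, map_one, PowerSeries.map_X]

/-- The action of an automorphism of `K` on the coefficients of Laurent series, as a homomorphism
over `ℚ(X)`. -/
noncomputable def coeffMap (τ : Gal(K/ℚ)) : K⸨X⸩ →ₐ[ℚ⟮X⟯] K⸨X⸩ :=
  { laurentMap (τ : K →+* K) with
    commutes' := fun r => DFunLike.congr_fun (laurentMap_comp_algebraMap (τ : K →+* K)) r }

/-- The Galois group of `K` acts on the coefficients of Laurent series. -/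
noncomputable def coeffAction : Gal(K/ℚ) →* Gal(K⸨X⸩/ℚ⟮X⟯) where
  toFun τ := AlgEquiv.ofAlgHom (coeffMap τ) (coeffMap τ⁻¹)
    (by ext x n; exact τ.apply_symm_apply _) (by ext x n; exact τ.symm_apply_apply _)
  map_one' := by ext x n; rfl
  map_mul' τ τ' := by ext x n; rfl

theorem coeff_coeffAction (τ : Gal(K/ℚ)) (x : K⸨X⸩) (n : ℤ) :
    (coeffAction τ x).coeff n = τ (x.coeff n) := rfl

theorem coeffAction_algebraMap (τ : Gal(K/ℚ)) (f : K⟦X⟧) :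
    coeffAction τ (algebraMap K⟦X⟧ K⸨X⸩ f) =
      algebraMap K⟦X⟧ K⸨X⸩ (PowerSeries.map (τ : K →+* K) f) := by
  exact laurentMap_algebraMap (τ : K →+* K) f


open IntermediateField

variable (K)

theorem one_sub_X_sq_ne_zero : (1 : K⟮X⟯) - algebraMap K[X] K⟮X⟯ Polynomial.X ^ 2 ≠ 0 := by
  rw [← map_pow, ← map_one (algebraMap K[X] K⟮X⟯), ← map_sub]
  refine (map_ne_zero_iff _ (IsFractionRing.injective K[X] K⟮X⟯)).2 fun h => ?_
  have := congrArg (Polynomial.coeff · 0) h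
  simp at this

/-- The coefficient `(c + 1) / (1 - T)` in `ℚ(T)`. -/
noncomputable def radicandCoeff (c : Fin 2) : ℚ⟮X⟯ :=
  algebraMap ℚ[X] ℚ⟮X⟯ (Polynomial.C ((c.val + 1 : ℕ) : ℚ)) /
    algebraMap ℚ[X] ℚ⟮X⟯ (1 - Polynomial.X)

theorem doubleCover_radicandCoeff (c : Fin 2) : doubleCover K (radicandCoeff c) =
    algebraMap K[X] K⟮X⟯ (Polynomial.C ((c.val + 1 : ℕ) : K)) /
      (1 - algebraMap K[X] K⟮X⟯ Polynomial.X ^ 2) := by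
  rw [radicandCoeff, map_div₀, map_sub, map_sub, doubleCover_X, map_one, map_one,
    doubleCover_algebraMap]
  simp

/-- The radicand `(t s + 1) / (t s - 1)` with `t = (c + 1) b / (1 - s ^ 2)` is a quotient of the
quadratic polynomials `quad`. -/
theorem radicand_eq (c : Fin 2) (b : K) :
    (algebraMap ℚ⟮X⟯ K⸨X⸩ (radicandCoeff c) *
          expandAtOne K (algebraMap K[X] K⟮X⟯ (Polynomial.C b)) *
          expandAtOne K (algebraMap K[X] K⟮X⟯ Polynomial.X) + 1) /
        (algebraMap ℚ⟮X⟯ K⸨X⸩ (radicandCoeff c) *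
          expandAtOne K (algebraMap K[X] K⟮X⟯ (Polynomial.C b)) *
          expandAtOne K (algebraMap K[X] K⟮X⟯ Polynomial.X) - 1) =
      expandAtOne K (algebraMap K[X] K⟮X⟯ (quad (((c.val + 1 : ℕ) : K) * b)) /
        -algebraMap K[X] K⟮X⟯ (quad (-(((c.val + 1 : ℕ) : K) * b)))) := by
  rw [doubleCoverAlgebra_algebraMap, ← map_one (expandAtOne K), ← map_mul, ← map_mul, ← map_add,
    ← map_sub, ← map_div₀, doubleCover_radicandCoeff]
  congr 1
  have h := one_sub_X_sq_ne_zero K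
  simp only [quad, map_add, map_sub, map_mul, map_pow, map_one, map_neg]
  rw [← mul_div_mul_right _ _ h]
  congr 1
  · field_simp
  · field_simp
    ring

variable {K}

/-- The radicands take the value `1` at `X = 1`, and so have roots among power series at `1`. -/
theorem exists_root_radicand {n : ℕ} (hn : n ≠ 0) {b : K} (hb : b ≠ 0) : ∃ w : K⸨X⸩,
    w ^ n = expandAtOne K (algebraMap K[X] K⟮X⟯ (quad b) / -algebraMap K[X] K⟮X⟯ (quad (-b))) := by
  set N : K⟦X⟧ := ((Polynomial.taylor 1 (quad b) : K[X]) : K⟦X⟧) with hN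
  set M : K⟦X⟧ := -((Polynomial.taylor 1 (quad (-b)) : K[X]) : K⟦X⟧) with hM
  have hN0 : PowerSeries.constantCoeff N = b := by
    rw [hN, Polynomial.constantCoeff_coe, Polynomial.taylor_coeff_zero]
    simp [quad]
  have hM0 : PowerSeries.constantCoeff M = b := by
    rw [hM, map_neg, Polynomial.constantCoeff_coe, Polynomial.taylor_coeff_zero]
    simp [quad]
  obtain ⟨g, hg⟩ := PowerSeries.exists_pow_eq hn (f := N * M⁻¹) (by
    rw [map_mul, PowerSeries.constantCoeff_inv, hN0, hM0, mul_inv_cancel₀ hb])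
  refine ⟨algebraMap K⟦X⟧ K⸨X⸩ g, ?_⟩
  have hM1 : M * M⁻¹ = 1 := PowerSeries.mul_inv_cancel M (hM0 ▸ hb)
  have hM2 : algebraMap K⟦X⟧ K⸨X⸩ M * algebraMap K⟦X⟧ K⸨X⸩ M⁻¹ = 1 := by
    rw [← map_mul, hM1, map_one]
  rw [← map_pow, hg, map_mul, map_div₀, map_neg, expandAtOne_algebraMap, expandAtOne_algebraMap,
    ← map_neg, ← hN, ← hM, eq_div_iff (left_ne_zero_of_mul_eq_one hM2), mul_assoc, mul_comm _
    (algebraMap K⟦X⟧ K⸨X⸩ M), hM2, mul_one]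

variable (K)

/-- The automorphism `X ↦ -X` of `K(X)`. -/
noncomputable def negX : K⟮X⟯ ≃+* K⟮X⟯ :=
  IsFractionRing.ringEquivOfRingEquiv (Polynomial.algEquivAevalNegX (R := K)).toRingEquiv

omit [CharZero K] in
theorem negX_algebraMap (P : K[X]) :
    negX K (algebraMap K[X] K⟮X⟯ P) = algebraMap K[X] K⟮X⟯ (Polynomial.algEquivAevalNegX P) :=
  IsFractionRing.ringEquivOfRingEquiv_algebraMap _ _

omit [CharZero K] in
theorem negX_X : negX K (algebraMap K[X] K⟮X⟯ Polynomial.X) =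
    -algebraMap K[X] K⟮X⟯ Polynomial.X := by
  rw [negX_algebraMap, ← map_neg]
  simp

theorem negX_comp_doubleCover : (negX K : K⟮X⟯ →+* K⟮X⟯).comp (doubleCover K) = doubleCover K := by
  apply ratFunc_ringHom_ext
  rw [RingHom.comp_apply, doubleCover_X, map_pow]
  change negX K _ ^ 2 = _
  rw [negX_X, neg_sq]

/-- The square root `X` of `X ^ 2` is not in the field generated by constants over `ℚ(X ^ 2)`, as
this is fixed by `X ↦ -X`. -/
theorem expandAtOne_X_notMem (b : K) : expandAtOne K (algebraMap K[X] K⟮X⟯ Polynomial.X) ∉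
    ℚ⟮X⟯⟮expandAtOne K (algebraMap K[X] K⟮X⟯ (Polynomial.C b))⟯ := by
  let S : Subfield K⟮X⟯ := RingHom.eqLocusField (negX K : K⟮X⟯ →+* K⟮X⟯) (RingHom.id _)
  let I : IntermediateField ℚ⟮X⟯ K⸨X⸩ := (S.map (expandAtOne K)).toIntermediateField fun f =>
    ⟨doubleCover K f, DFunLike.congr_fun (negX_comp_doubleCover K) f, rfl⟩
  have hle : ℚ⟮X⟯⟮expandAtOne K (algebraMap K[X] K⟮X⟯ (Polynomial.C b))⟯ ≤ I := by
    rw [adjoin_simple_le_iff]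
    refine ⟨_, ?_, rfl⟩
    change negX K _ = _
    rw [negX_algebraMap]
    simp
  intro h
  obtain ⟨f, hf, hfX⟩ := hle h
  have hfX' := (expandAtOne K).injective hfX
  subst hfX'
  have h1 : negX K _ = _ := hf
  rw [negX_X, RingHom.id_apply, neg_eq_self] at h1
  exact (map_ne_zero_iff _ (IsFractionRing.injective K[X] K⟮X⟯)).2 Polynomial.X_ne_zero h1

theorem adjoin_le_range_expandAtOne (f g : K⟮X⟯) {u : K⸨X⸩}
    (hu : u ∈ adjoin ℚ⟮X⟯ {expandAtOne K f, expandAtOne K g}) : ∃ U, expandAtOne K U = u := by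
  let I : IntermediateField ℚ⟮X⟯ K⸨X⸩ := (expandAtOne K).fieldRange.toIntermediateField fun f =>
    ⟨doubleCover K f, rfl⟩
  have hle : adjoin ℚ⟮X⟯ {expandAtOne K f, expandAtOne K g} ≤ I := by
    rw [adjoin_le_iff]
    rintro _ (rfl | rfl)
    · exact ⟨f, rfl⟩
    · exact ⟨g, rfl⟩
  exact hle hu

/-- Over `K = ℚ(ζ)`, the function field of the double cover and the roots of the radicands give
Kummer data in the field of Laurent series. -/
theorem exists_dihedralKummerData (p : ℕ) [Fact p.Prime] (hp : p ≠ 2) [NumberField K]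
    [IsCyclotomicExtension {p} ℚ K] : ∃ d : DihedralKummerData p ℚ⟮X⟯ K⸨X⸩,
      d.s = expandAtOne K (algebraMap K[X] K⟮X⟯ Polynomial.X) ∧
      ∀ τ : Gal(K/ℚ), ∃ b, d.D b = coeffAction τ := by
  have hζ := IsCyclotomicExtension.zeta_spec p ℚ K
  set ζ := IsCyclotomicExtension.zeta p ℚ K
  choose w hw using fun c : Fin 2 => exists_root_radicand (K := K) (n := p) (NeZero.ne p)
    (b := ((c.val + 1 : ℕ) : K) * ζ)
    (mul_ne_zero (Nat.cast_ne_zero.2 (Nat.succ_ne_zero _)) (hζ.ne_zero (NeZero.ne p)))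
  let ζ' := expandAtOne K (algebraMap K[X] K⟮X⟯ (Polynomial.C ζ))
  have hζpow : ∀ i : ℕ, ζ' ^ i = expandAtOne K (algebraMap K[X] K⟮X⟯ (Polynomial.C (ζ ^ i))) :=
    fun i => by simp only [ζ', map_pow]
  refine ⟨DihedralKummerData.ofRoots
    (coeffAction.comp (IsCyclotomicExtension.Rat.galEquivZMod p K).symm.toMonoidHom) ζ'
    (expandAtOne K (algebraMap K[X] K⟮X⟯ Polynomial.X)) radicandCoeff w ?_ ?_ ?_ ?_ ?_ ?_ ?_,
    rfl, ?_⟩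
  · exact hζ.map_of_injective (f := ((expandAtOne K).comp (algebraMap K[X] K⟮X⟯)).comp Polynomial.C)
      (RingHom.injective _)
  · exact ⟨algebraMap ℚ[X] ℚ⟮X⟯ Polynomial.X, by
      rw [doubleCoverAlgebra_algebraMap, doubleCover_X, map_pow]⟩
  · intro b
    rw [hζpow]
    simp only [ζ', expandAtOne_C]
    change coeffAction _ _ = _
    rw [coeffAction_algebraMap, PowerSeries.map_C]
    congr 2
    have := IsCyclotomicExtension.Rat.galEquivZMod_apply_of_pow_eq p K
      ((IsCyclotomicExtension.Rat.galEquivZMod p K).symm b) hζ.pow_eq_one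
    rwa [MulEquiv.apply_symm_apply] at this
  · intro b
    rw [expandAtOne_X]
    change coeffAction _ _ = _
    rw [coeffAction_algebraMap, map_add, map_one, PowerSeries.map_X]
  · intro c
    rw [hw, radicand_eq]
  · exact expandAtOne_X_notMem K ζ
  · intro m u hu h
    obtain ⟨U, rfl⟩ := adjoin_le_range_expandAtOne K _ _ hu
    refine dvd_of_prod_quad_eq_pow hp hζ m U ((expandAtOne K).injective ?_)
    simp only [hζpow, radicand_eq] at h
    rw [map_pow, ← h]
    simp only [map_prod, map_pow]
  · intro τ
    refine ⟨IsCyclotomicExtension.Rat.galEquivZMod p K τ, ?_⟩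
    change coeffAction ((IsCyclotomicExtension.Rat.galEquivZMod p K).symm _) = _
    rw [MulEquiv.symm_apply_apply]

end Laurent

end DoubleCover

open scoped PowerSeries LaurentSeries

/-! ### Regularity and specialisations -/

section RegularityAndSpecialisation

section Constants

variable {K : Type*} [Field K]

theorem PowerSeries.eq_zero_of_isIntegral_of_constantCoeff_eq_zero {k : Type*} [Field k]
    [Algebra k K] {g : K⟦X⟧} (hg : IsIntegral k g) (h0 : PowerSeries.constantCoeff g = 0) :
    g = 0 := by
  rw [← minpoly.coeff_zero_eq_zero hg]
  have h1 := congrArg PowerSeries.constantCoeff (minpoly.aeval k g)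
  rw [Polynomial.aeval_def, Polynomial.hom_eval₂, h0, Polynomial.eval₂_at_zero, map_zero] at h1
  exact (_root_.map_eq_zero _).1 h1

/-- A Laurent series over `K` that is integral over a subfield of `K` is a constant. -/
theorem LaurentSeries.eq_C_of_isIntegral [CharZero K] [Algebra.IsIntegral ℚ K] {x : K⸨X⸩}
    (hx : IsIntegral ℚ x) : x = algebraMap K⟦X⟧ K⸨X⸩ (PowerSeries.C (x.coeff 0)) := by
  have hx' : IsIntegral K⟦X⟧ x := by
    obtain ⟨P, hP, h⟩ := hx
    refine ⟨P.map (algebraMap ℚ K⟦X⟧), hP.map _, ?_⟩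
    rwa [Polynomial.eval₂_map, Subsingleton.elim ((algebraMap K⟦X⟧ K⸨X⸩).comp _)
      (algebraMap ℚ K⸨X⸩)]
  obtain ⟨f, rfl⟩ := IsIntegrallyClosed.isIntegral_iff.1 hx'
  have hf : IsIntegral ℚ f :=
    (isIntegral_algHom_iff (algebraMap K⟦X⟧ K⸨X⸩).toRatAlgHom
      (IsFractionRing.injective K⟦X⟧ K⸨X⸩)).1 hx
  have hc : (algebraMap K⟦X⟧ K⸨X⸩ f).coeff 0 = PowerSeries.constantCoeff f := by
    rw [LaurentSeries.coe_algebraMap, PowerSeries.coeff_coe]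
    simp
  have hC : IsIntegral ℚ (PowerSeries.C (PowerSeries.constantCoeff f)) :=
    (Algebra.IsIntegral.isIntegral (R := ℚ) (PowerSeries.constantCoeff f)).map
      (PowerSeries.C (R := K)).toRatAlgHom
  have := PowerSeries.eq_zero_of_isIntegral_of_constantCoeff_eq_zero (hf.sub hC) (by simp)
  rw [hc, ← sub_eq_zero.1 this]

variable (K) in
/-- Power series, as a subring of Laurent series. -/
noncomputable def powerSeriesEquivRange : K⟦X⟧ ≃+* (algebraMap K⟦X⟧ K⸨X⸩).range :=
  RingEquiv.ofBijective (algebraMap K⟦X⟧ K⸨X⸩).rangeRestrict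
    ⟨fun _ _ h => IsFractionRing.injective K⟦X⟧ K⸨X⸩ (congrArg Subtype.val h),
      (algebraMap K⟦X⟧ K⸨X⸩).rangeRestrict_surjective⟩

end Constants

section NumberFields

theorem isUnramifiedAtNat_of_surjective {F : Type*} [Field F] (ρ : ℚ →+* F)
    (hρ : Function.Surjective ρ) (p : ℕ) : IsUnramifiedAtNat F p := by
  have hsurj : Function.Surjective (algebraMap ℤ (𝓞 F)) := by
    intro x
    obtain ⟨q, hq⟩ := hρ x
    have hint : IsIntegral ℤ q := by
      have hx : IsIntegral ℤ (ρ.toIntAlgHom q) := by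
        change IsIntegral ℤ (ρ q)
        rw [hq]
        exact x.2
      exact (isIntegral_algHom_iff ρ.toIntAlgHom ρ.injective).1 hx
    obtain ⟨n, rfl⟩ := IsIntegrallyClosed.isIntegral_iff.1 hint
    refine ⟨n, NumberField.RingOfIntegers.ext ?_⟩
    rw [← hq]
    simp
  intro P hP _
  have : Algebra.FormallyUnramified ℤ (𝓞 F) :=
    Algebra.FormallyUnramified.of_surjective (Algebra.ofId ℤ (𝓞 F)) hsurj
  have : Algebra.FormallyUnramified (𝓞 F) (Localization.AtPrime P) :=
    Algebra.FormallyUnramified.of_isLocalization P.primeCompl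
  exact Algebra.FormallyUnramified.comp ℤ (𝓞 F) (Localization.AtPrime P)

theorem isTotallyComplex_of_sq_eq_neg_one {F : Type*} [Field F] {y : F} (hy : y ^ 2 = -1) :
    NumberField.IsTotallyComplex F := by
  refine ⟨fun v => NumberField.InfinitePlace.not_isReal_iff_isComplex.1 fun hv => ?_⟩
  have h := congrArg (NumberField.InfinitePlace.embedding_of_isReal hv) hy
  rw [map_pow, map_neg, map_one] at h
  nlinarith [sq_nonneg (NumberField.InfinitePlace.embedding_of_isReal hv y)]

end NumberFields

section Specialisations

variable {E : Type*} [Field E] [Algebra ℚ[X] E] [Algebra ℚ⟮X⟯ E] [IsScalarTower ℚ[X] ℚ⟮X⟯ E]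

/-- If `E` contains a square root of `T`, the specialisation at `-1` contains a square root of
`-1`. -/
theorem isTotallyComplex_specialisation {e : E} (he : e ^ 2 = algebraMap ℚ[X] E Polynomial.X) :
    NumberField.IsTotallyComplex (Specialisation ℚ E (-1)) := by
  have hint : IsIntegral ℚ[X] e := IsIntegral.of_pow two_pos (he ▸ isIntegral_algebraMap)
  let o : FunctionField.ringOfIntegers ℚ E := ⟨e, hint⟩
  have ho : o ^ 2 = algebraMap ℚ[X] _ Polynomial.X := Subtype.ext he
  have hmem : algebraMap ℚ[X] (FunctionField.ringOfIntegers ℚ E)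
      (Polynomial.X - Polynomial.C (-1)) ∈ specialisationIdeal ℚ E (-1) := by
    have h := (specialisationIdeal_liesOver ℚ E (-1)).over
    have h1 : Polynomial.X - Polynomial.C (-1 : ℚ) ∈
        (specialisationIdeal ℚ E (-1)).under ℚ[X] := h ▸ Ideal.mem_span_singleton_self _
    exact h1
  rw [← Ideal.algebraMap_residueField_eq_zero, map_neg, sub_neg_eq_add, map_add, map_one, map_one,
    map_add, map_one, ← ho, map_pow] at hmem
  exact isTotallyComplex_of_sq_eq_neg_one (eq_neg_of_add_eq_zero_left hmem)

section AtOne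

variable {K : Type*} [Field K] [NumberField K] {j : E →+* K⸨X⸩}
  (hj : ∀ f : ℚ⟮X⟯, j (algebraMap ℚ⟮X⟯ E f) = expandAtOne K (doubleCover K f))
  (hfix : ∀ (x : E) (τ : Gal(K/ℚ)), coeffAction τ (j x) = j x)

include hfix

omit [Algebra ℚ[X] E] [Algebra ℚ⟮X⟯ E] [IsScalarTower ℚ[X] ℚ⟮X⟯ E] in
theorem exists_rat_coeff [IsGalois ℚ K] (x : E) (n : ℤ) : ∃ q : ℚ, algebraMap ℚ K q = (j x).coeff n := by
  refine (IsGalois.mem_range_algebraMap_iff_fixed _).2 fun τ => ?_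
  rw [← coeff_coeffAction, hfix]

omit [Algebra ℚ[X] E] [Algebra ℚ⟮X⟯ E] [IsScalarTower ℚ[X] ℚ⟮X⟯ E] in
/-- A field that embeds in `ℚ((X))` is regular over `ℚ`. -/
theorem isRegularExtension_of_laurent [IsGalois ℚ K] [Algebra ℚ E] : IsRegularExtension ℚ E := by
  refine eq_bot_iff.2 fun x hx => ?_
  have hx' : IsIntegral ℚ (j x) := by
    obtain ⟨P, hP, h⟩ := mem_algebraicClosure_iff'.1 hx
    refine ⟨P, hP, ?_⟩
    rw [Subsingleton.elim (algebraMap ℚ K⸨X⸩) (j.comp (algebraMap ℚ E)), ← Polynomial.hom_eval₂, h,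
      map_zero]
  obtain ⟨q, hq⟩ := exists_rat_coeff hfix x 0
  refine IntermediateField.mem_bot.2 ⟨q, j.injective ?_⟩
  rw [LaurentSeries.eq_C_of_isIntegral hx', ← hq]
  exact DFunLike.congr_fun (Subsingleton.elim (j.comp (algebraMap ℚ E))
    ((algebraMap K⟦X⟧ K⸨X⸩).comp ((PowerSeries.C (R := K)).comp (algebraMap ℚ K)))) q

omit hfix
include hj

theorem map_algebraMap_polynomial (P : ℚ[X]) : j (algebraMap ℚ[X] E P) =
    algebraMap K⟦X⟧ K⸨X⸩ ((Polynomial.taylor 1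
      (Polynomial.expand K 2 (P.map (algebraMap ℚ K))) : K[X]) : K⟦X⟧) := by
  rw [IsScalarTower.algebraMap_apply ℚ[X] ℚ⟮X⟯ E, hj, doubleCover_algebraMap,
    expandAtOne_algebraMap]

theorem exists_powerSeries (o : FunctionField.ringOfIntegers ℚ E) :
    ∃ f : K⟦X⟧, algebraMap K⟦X⟧ K⸨X⸩ f = j (algebraMap _ E o) := by
  refine IsIntegrallyClosed.isIntegral_iff.1 ?_
  let φ : ℚ[X] →+* K⟦X⟧ := Polynomial.coeToPowerSeries.ringHom.comp
    ((Polynomial.taylorAlgHom (1 : K) : K[X] →+* K[X]).comp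
      ((Polynomial.expand K 2 : K[X] →+* K[X]).comp (Polynomial.mapRingHom (algebraMap ℚ K))))
  have hφ : (algebraMap K⟦X⟧ K⸨X⸩).comp φ = j.comp (algebraMap ℚ[X] E) :=
    RingHom.ext fun P => (map_algebraMap_polynomial hj P).symm
  obtain ⟨P, hP, h⟩ := o.2
  refine ⟨P.map φ, hP.map _, ?_⟩
  have h1 := congrArg j h
  rw [Polynomial.hom_eval₂, map_zero] at h1
  rw [Polynomial.eval₂_map, hφ]
  exact h1

/-- The constant coefficient of the Laurent expansion at `1`, on the integral closure of
`ℚ[T]`. -/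
noncomputable def residueAtOne : FunctionField.ringOfIntegers ℚ E →+* K :=
  PowerSeries.constantCoeff.comp (((powerSeriesEquivRange K).symm : _ →+* K⟦X⟧).comp
    ((j.comp (algebraMap (FunctionField.ringOfIntegers ℚ E) E)).codRestrict
      (algebraMap K⟦X⟧ K⸨X⸩).range (exists_powerSeries hj)))

theorem residueAtOne_eq (o : FunctionField.ringOfIntegers ℚ E) :
    residueAtOne hj o = (j (algebraMap _ E o)).coeff 0 := by
  obtain ⟨f, hf⟩ := exists_powerSeries hj o
  have h : residueAtOne hj o = PowerSeries.constantCoeff f := by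
    refine congrArg PowerSeries.constantCoeff
      (((powerSeriesEquivRange K).symm_apply_eq (x := ⟨_, exists_powerSeries hj o⟩)).2 ?_)
    exact Subtype.ext hf.symm
  rw [h, ← hf, LaurentSeries.coe_algebraMap, PowerSeries.coeff_coe]
  simp

theorem residueAtOne_algebraMap (P : ℚ[X]) :
    residueAtOne hj (algebraMap ℚ[X] _ P) = algebraMap ℚ K (P.eval 1) := by
  rw [residueAtOne_eq, ← IsScalarTower.algebraMap_apply ℚ[X] _ E, map_algebraMap_polynomial hj,
    LaurentSeries.coe_algebraMap, PowerSeries.coeff_coe]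
  simp only [lt_irrefl, if_false, Int.natAbs_zero, PowerSeries.coeff_zero_eq_constantCoeff_apply,
    Polynomial.constantCoeff_coe, Polynomial.taylor_coeff_zero, Polynomial.expand_eval, one_pow]
  rw [Polynomial.eval_map, Polynomial.eval₂_at_one]

theorem ker_residueAtOne_mem_primesOver : RingHom.ker (residueAtOne hj) ∈
    Ideal.primesOver (Ideal.span {(Polynomial.X - Polynomial.C 1 : ℚ[X])})
      (FunctionField.ringOfIntegers ℚ E) := by
  refine ⟨RingHom.ker_isPrime _, ⟨?_⟩⟩
  have hmax : (Ideal.span {(Polynomial.X - Polynomial.C 1 : ℚ[X])}).IsMaximal :=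
    PrincipalIdealRing.isMaximal_of_irreducible (Polynomial.irreducible_X_sub_C 1)
  have : ((RingHom.ker (residueAtOne hj)).under ℚ[X]).IsPrime :=
    (RingHom.ker_isPrime (residueAtOne hj)).under ℚ[X]
  refine hmax.eq_of_le this.ne_top ?_
  rw [Ideal.span_singleton_le_iff_mem, Ideal.under_def, Ideal.mem_comap, RingHom.mem_ker,
    residueAtOne_algebraMap]
  simp

include hfix

/-- The residue field at `1` is `ℚ`: the primes above `⟨T - 1⟩` are conjugate, and one of them is
the kernel of evaluation at the rational point `1` of Laurent expansions with rational
coefficients. -/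
theorem isUnramifiedAtNat_specialisation [IsGalois ℚ K] [FiniteDimensional ℚ⟮X⟯ E]
    [IsGalois ℚ⟮X⟯ E] (p : ℕ) : IsUnramifiedAtNat (Specialisation ℚ E 1) p := by
  set O := FunctionField.ringOfIntegers ℚ E
  set P := specialisationIdeal ℚ E 1
  obtain ⟨σ, hσ⟩ := Ideal.exists_comap_galRestrict_eq ℚ[X] ℚ⟮X⟯ E O
    (ker_residueAtOne_mem_primesOver hj)
    (⟨(specialisationIdeal_isMaximal ℚ E 1).isPrime, specialisationIdeal_liesOver ℚ E 1⟩ :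
      P ∈ Ideal.primesOver (Ideal.span {(Polynomial.X - Polynomial.C 1 : ℚ[X])}) O)
  -- every element of the integral closure is congruent to a rational number
  have key : ∀ o : O, ∃ q : ℚ, o - algebraMap ℚ[X] O (Polynomial.C q) ∈ P := by
    intro o
    obtain ⟨q, hq⟩ := exists_rat_coeff hfix (algebraMap O E (galRestrict ℚ[X] ℚ⟮X⟯ E O σ o)) 0
    refine ⟨q, ?_⟩
    rw [← hσ, Ideal.mem_comap, map_sub, AlgEquiv.commutes, RingHom.mem_ker, map_sub,
      residueAtOne_algebraMap, residueAtOne_eq, ← hq, Polynomial.eval_C, sub_self]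
  let ρ : ℚ →+* Specialisation ℚ E 1 :=
    (algebraMap O P.ResidueField).comp ((algebraMap ℚ[X] O).comp Polynomial.C)
  refine isUnramifiedAtNat_of_surjective ρ (fun y => ?_) p
  obtain ⟨o', ho'⟩ := P.bijective_algebraMap_quotient_residueField.2 y
  obtain ⟨o, rfl⟩ := Ideal.Quotient.mk_surjective o'
  obtain ⟨q, hq⟩ := key o
  refine ⟨q, ?_⟩
  rw [← Ideal.algebraMap_residueField_eq_zero, map_sub, sub_eq_zero] at hq
  rw [← ho']
  exact hq.symm

end AtOne

end Specialisations

end RegularityAndSpecialisation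

/-! ### The extension -/

attribute [local instance] doubleCoverAlgebra in
/-- The generalized dihedral extension `E` of `ℚ(T)`, embedded in `K((X))`, where `K = ℚ(ζ)`, in
such a way that the Laurent expansions of its elements have rational coefficients. -/
theorem exists_genDihedral_extension (p : ℕ) [Fact p.Prime] (hp : p ≠ 2) (K : Type) [Field K]
    [NumberField K] [IsCyclotomicExtension {p} ℚ K] :
    ∃ (E : Type) (_ : Field E) (_ : Algebra ℚ⟮X⟯ E) (j : E →+* LaurentSeries K),
      FiniteDimensional ℚ⟮X⟯ E ∧ IsGalois ℚ⟮X⟯ E ∧ Nonempty (Gal(E/ℚ⟮X⟯) ≃* GenDihedral p) ∧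
      (∃ e : E, e ^ 2 = algebraMap ℚ⟮X⟯ E (algebraMap ℚ[X] ℚ⟮X⟯ Polynomial.X)) ∧
      (∀ f : ℚ⟮X⟯, j (algebraMap ℚ⟮X⟯ E f) = expandAtOne K (doubleCover K f)) ∧
      ∀ (x : E) (τ : Gal(K/ℚ)), coeffAction τ (j x) = j x := by
  obtain ⟨d, hds, hdD⟩ := exists_dihedralKummerData K p hp
  obtain ⟨E, hfin, hgal, he, hs, hE⟩ := d.exists_extension
  refine ⟨E, E.toField, E.algebra', algebraMap E (LaurentSeries K), hfin, hgal, he,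
    ⟨⟨d.s, hs⟩, Subtype.ext ?_⟩, fun f => rfl, fun x τ => ?_⟩
  · change d.s ^ 2 = expandAtOne K (doubleCover K _)
    rw [hds, doubleCover_X, map_pow]
  · obtain ⟨b, hb⟩ := hdD τ
    rw [← hb]
    exact hE x x.2 b

theorem mainTheorem12 (p : ℕ) [Fact p.Prime] (hp : p ≠ 2) :
    ∃ (G : Type) (_ : Group G)
      (E : Type) (_ : Field E) (_ : Algebra ℚ E) (_ : Algebra ℚ[X] E) (_ : Algebra ℚ⟮X⟯ E)
      (_ : IsScalarTower ℚ ℚ⟮X⟯ E) (_ : IsScalarTower ℚ[X] ℚ⟮X⟯ E),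
      Nat.card G = 2 * p ^ 2 ∧
      FiniteDimensional ℚ⟮X⟯ E ∧
      IsGalois ℚ⟮X⟯ E ∧
      Nonempty (Gal(E/ℚ⟮X⟯) ≃* G) ∧
      IsRegularExtension ℚ E ∧
      (∃ φ : G →* PGL(2, AlgebraicClosure (ZMod p)), Function.Injective φ) ∧
      (¬ ∃ ψ : G →* PGL(2, ℂ), Function.Injective ψ) ∧
      (∃ t₀ : ℚ, NumberField.IsTotallyComplex (Specialisation ℚ E t₀)) ∧
      (∃ t₀ : ℚ, IsUnramifiedAtNat (Specialisation ℚ E t₀) p) := by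
  have : IsCyclotomicExtension {p} ℚ (CyclotomicField p ℚ) :=
    CyclotomicField.isCyclotomicExtension p ℚ
  have : IsGalois ℚ (CyclotomicField p ℚ) := IsCyclotomicExtension.isGalois {p} ℚ _
  obtain ⟨E, _, _, j, hfin, hgal, hG, ⟨e, he⟩, hj, hfix⟩ :=
    exists_genDihedral_extension p hp (CyclotomicField p ℚ)
  let iX : Algebra ℚ[X] E := ((algebraMap ℚ⟮X⟯ E).comp (algebraMap ℚ[X] ℚ⟮X⟯)).toAlgebra
  have hX : IsScalarTower ℚ[X] ℚ⟮X⟯ E := IsScalarTower.of_algebraMap_eq' rfl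
  let iQ : Algebra ℚ E := ((algebraMap ℚ⟮X⟯ E).comp RatFunc.C).toAlgebra
  have hQ : IsScalarTower ℚ ℚ⟮X⟯ E := ⟨fun a b c => by
    rw [RatFunc.smul_eq_C_mul, Algebra.smul_def, Algebra.smul_def b, Algebra.smul_def a, map_mul, mul_assoc]
    rfl⟩
  exact ⟨GenDihedral p, inferInstance, E, inferInstance, iQ, iX, inferInstance, hQ, hX,
    GenDihedral.natCard p, hfin, hgal, hG, isRegularExtension_of_laurent hfix,
    GenDihedral.exists_injective_toPGL_algebraicClosure p hp,
    GenDihedral.not_exists_injective_toPGL_complex p hp,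
    ⟨-1, isTotallyComplex_specialisation he⟩,
    ⟨1, isUnramifiedAtNat_specialisation hj hfix p⟩⟩
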